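/- Let $p,q,n\ge 0$ be integers, $m=p+q$ and $\theta\in\{1,-1\}$; everything is over $\mathbb C$. **The algebra $\mathrm A$.** Let $\mathcal{HD}$ be the algebra with generators $x_{ai},\partial_{ai}$ ($1\le a\le m$, $1\le i\le n$) and relations $$x_{ai}x_{bj}-\theta x_{bj}x_{ai}=0,\qquad \partial_{ai}\partial_{bj}-\theta\,\partial_{bj}\partial_{ai}=0,\qquad \partial_{ai}x_{bj}-\theta x_{bj}\partial_{ai}=\delta_{ab}\delta_{ij}.$$ Put $p_{ai}=-\theta x_{ai}$, $q_{ai}=\partial_{ai}$ for $a\le p$, and $p_{ai}=\partial_{ai}$, $q_{ai}=x_{ai}$ for $a>p$; let $\zeta(E_{ab})=\theta\delta_{ab}\frac n2+\sum_{k=1}^n q_{ak}p_{bk}$. Let $\mathrm A$ be the algebra generated by $\mathrm U(\mathfrak{gl}_m)$ and $\mathcal{HD}$ with the cross relations $[X,Y]=[\zeta(X),Y]$ for $X\in\mathfrak{gl}_m$, $Y\in\mathcal{HD}$. Let $\bar{\mathrm A}$ be the (Ore) ring of fractions of $\mathrm A$ relative to the set of denominators $E_{aa}-E_{bb}+z$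 with $a\ne b$ and $z\in\mathbb Z$, and let $\overline{\mathrm U(\mathfrak h)}$ be the corresponding ring of fractions of $\mathrm U(\mathfrak h)=\mathbb C[E_{11},\dots,E_{mm}]$; its elements are rational functions on $\mathfrak h^*$. The group $S_m$ acts by automorphisms of $\mathrm A$ and $\bar{\mathrm A}$ through $E_{ab}\mapsto E_{\sigma(a)\sigma(b)}$, $p_{ai}\mapsto p_{\sigma(a)i}$, $q_{ai}\mapsto q_{\sigma(a)i}$. Let $\bar{\mathrm J}$ be the right ideal of $\bar{\mathrm A}$ generated by the elements $E_{ba}$ with $a<b$. **Zhelobenko operators.** For $1\le c\le m-1$ put $E_c=E_{c,c+1}$, $F_c=E_{c+1,c}$, $H_c=E_{cc}-E_{c+1,c+1}$, $\eta_c=E_{cc}^*-E_{c+1,c+1}^*$, $H_c^{(s)}=H_c(H_c-1)\cdots(H_c-s+1)$, let $\sigma_c\in S_m$ be the transposition of $c$ and $c+1$, and for $Y\in\mathrm A$ put $$\xi_c(Y)=Y+\sum_{s\ge1}\bigl(s!\,H_c^{(s)}\bigr)^{-1}E_c^s\,(\operatorname{ad}F_c)^s(Y)\in\bar{\mathrm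 A}$$ (a finite sum). Let $\bar\xi_c:\bar{\mathrm A}\to\bar{\mathrm J}\backslash\bar{\mathrm A}$ be the unique linear map with $\bar\xi_c(XY)=Z\,\xi_c(Y)+\bar{\mathrm J}$ for $X\in\overline{\mathrm U(\mathfrak h)}$, $Y\in\mathrm A$, where $Z(\mu)=X(\mu+\eta_c)$. The Zhelobenko operator $\check\xi_c:\bar{\mathrm J}\backslash\bar{\mathrm A}\to\bar{\mathrm J}\backslash\bar{\mathrm A}$ is the map induced by $\bar\xi_c\,\sigma_c$. For $\sigma\in S_m$ with a reduced decomposition $\sigma=\sigma_{c_1}\cdots\sigma_{c_k}$ put $\check\xi_\sigma=\check\xi_{c_1}\cdots\check\xi_{c_k}$. **The ideals.** For $\delta\in\{1,-1\}^m$ let $\bar{\mathrm I}_\delta$ be the left ideal of $\bar{\mathrm A}$ generated by the elements $x_{ak}$ with $\delta_a=-1$ and $\partial_{ak}$ with $\delta_a=1$ ($1\le k\le n$). Put $\overline\delta=(\delta_1,\dots,\delta_p,-\delta_{p+1},\dots,-\delta_m)$, let $(\sigma\cdot\delta)_a=\delta_{\sigma^{-1}(a)}$ and $\sigma(\delta)=\overline{\sigma\cdot\overline\delta}$,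 and let $\delta^+=(1,\dots,1)$. **Proposition.** For every $\sigma\in S_m$, and for every reduced decomposition of $\sigma$ used to define it, the operator $\check\xi_\sigma$ maps the image of $\bar{\mathrm I}_{\delta^+}$ in $\bar{\mathrm J}\backslash\bar{\mathrm A}$ into the image of $\bar{\mathrm I}_{\sigma(\delta^+)}$ in $\bar{\mathrm J}\backslash\bar{\mathrm A}$. -/

import Mathlib

/- Overview, with `m = p + q`, indices starting from `0`, and `θ = ±1` as an element of `ℤˣ`.

`A`            the algebra generated by `U(gl_m)` and `HD` with the cross relations
`A.perm σ`     the action of the symmetric group on `A`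
`Ab`           the ring of fractions of `A` relative to the denominators `E_{aa} - E_{bb} + z`
               (the Ore condition is proved first); `Ab.of : A → Ab`
`Ab.perm σ`    the action of the symmetric group on `Ab`
`Jb`           the right ideal of `Ab` generated by the `E_{ba}`, `a < b`
`xi c`         the map `ξ_c : A → Ab`
`xiBar c`      the map `ξ̄_c : Ab → Jb \ Ab`, with `ξ̄_c(X Y) = Z ξ_c(Y) + Jb`
`zhelobenko c` the operator `ξ̌_c` on `Jb \ Ab`, induced by `ξ̄_c σ_c`
`Ib δ`, `IbImage δ`  the left ideal `Ī_δ` of `Ab` and its image in `Jb \ Ab`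
`actSeq σ δ`   the sequence `σ(δ)`

The lemmas in between prove that these are well defined. -/

namespace Zhelobenko

noncomputable section

/-- The coordinates `q_{ai}`: `∂_{ai}` for the first `p` values of `a`, and `x_{ai}` for the others. -/
def coordQ {m n : ℕ} (p : ℕ) {B : Type} (x d : Fin m → Fin n → B) (a : Fin m) (i : Fin n) : B :=
  if a.val < p then d a i else x a i

/-- The coordinates `p_{ai}`: `-θ x_{ai}` for the first `p` values of `a`, and `∂_{ai}` for the
others. -/
def coordP {m n : ℕ} (p : ℕ) (θ : ℤˣ) {B : Type} [Ring B] (x d : Fin m → Fin n → B)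
    (a : Fin m) (i : Fin n) : B :=
  if a.val < p then -(θ • x a i) else d a i

/-- The element `ζ(E_{ab}) = θ δ_{ab} n / 2 + ∑_k q_{ak} p_{bk}`. -/
def zeta {m n : ℕ} (p : ℕ) (θ : ℤˣ) {B : Type} [Ring B] [Algebra ℂ B] (x d : Fin m → Fin n → B)
    (a b : Fin m) : B :=
  (if a = b then algebraMap ℂ B (((θ : ℤ) : ℂ) * (n : ℂ) / 2) else 0) +
    ∑ k : Fin n, coordQ p x d a k * coordP p θ x d b k

/-- The generators: `E_{ab}` of `U(gl_m)`, and `x_{ai}`, `∂_{ai}` of the algebra `HD`. -/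
inductive Gen (m n : ℕ) : Type
  | E (a b : Fin m) : Gen m n
  | x (a : Fin m) (i : Fin n) : Gen m n
  | d (a : Fin m) (i : Fin n) : Gen m n

/-- The defining relations, for elements `E a b`, `x a i`, `d a i` of a `ℂ`-algebra:
those of `U(gl_m)`, those of `HD`, and the cross relations `[X, Y] = [ζ(X), Y]`. -/
structure Relations {m n : ℕ} (p : ℕ) (θ : ℤˣ) {B : Type} [Ring B] [Algebra ℂ B]
    (E : Fin m → Fin m → B) (x d : Fin m → Fin n → B) : Prop where
  EE : ∀ a b c e, E a b * E c e - E c e * E a b =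
    (if b = c then E a e else 0) - (if a = e then E c b else 0)
  xx : ∀ a b i j, x a i * x b j - θ • (x b j * x a i) = 0
  dd : ∀ a b i j, d a i * d b j - θ • (d b j * d a i) = 0
  dx : ∀ a b i j, d a i * x b j - θ • (x b j * d a i) = if a = b ∧ i = j then 1 else 0
  Ex : ∀ a b c i, E a b * x c i - x c i * E a b =
    zeta p θ x d a b * x c i - x c i * zeta p θ x d a b
  Ed : ∀ a b c i, E a b * d c i - d c i * E a b =
    zeta p θ x d a b * d c i - d c i * zeta p θ x d a b

/-- The same relations in terms of the coordinates `p_{ai}`, `q_{ai}`. -/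
structure PQ {m n : ℕ} (θ : ℤˣ) {B : Type} [Ring B] (E : Fin m → Fin m → B)
    (P Q : Fin m → Fin n → B) : Prop where
  EE : ∀ a b c e, E a b * E c e - E c e * E a b =
    (if b = c then E a e else 0) - (if a = e then E c b else 0)
  qq : ∀ a b i j, Q a i * Q b j = θ • (Q b j * Q a i)
  pp : ∀ a b i j, P a i * P b j = θ • (P b j * P a i)
  pq : ∀ a b i j, P a i * Q b j = θ • (Q b j * P a i) + if a = b ∧ i = j then 1 else 0
  Eq : ∀ a b c i, E a b * Q c i - Q c i * E a b = if b = c then Q a i else 0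
  Ep : ∀ a b c i, E a b * P c i - P c i * E a b = if a = c then - P b i else 0

section
variable {m n : ℕ} {p : ℕ} {θ : ℤˣ} {B : Type} [Ring B] [Algebra ℂ B]
    {E : Fin m → Fin m → B} {x d : Fin m → Fin n → B}

theorem comm_zeta_q {P Q : Fin m → Fin n → B} (z : ℂ)
    (qq : ∀ a b i j, Q a i * Q b j = θ • (Q b j * Q a i))
    (pq : ∀ a b i j, P a i * Q b j = θ • (Q b j * P a i) + if a = b ∧ i = j then 1 else 0)
    (a b c : Fin m) (i : Fin n) :
    ((if a = b then algebraMap ℂ B z else 0) + ∑ k, Q a k * P b k) * Q c i -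
      Q c i * ((if a = b then algebraMap ℂ B z else 0) + ∑ k, Q a k * P b k) =
      if b = c then Q a i else 0 := by
  have h : ∀ k, Q a k * P b k * Q c i = Q c i * (Q a k * P b k) +
      (if b = c then (if k = i then Q a k else 0) else 0) := by
    intro k
    rw [mul_assoc, pq, ← mul_assoc (Q c i), qq c a]
    clear qq pq
    rcases Int.units_eq_one_or θ with rfl | rfl <;>
      (split_ifs <;> simp_all [mul_add, mul_assoc])
  have hz : (if a = b then algebraMap ℂ B z else 0) * Q c i =
      Q c i * (if a = b then algebraMap ℂ B z else 0) := by
    split_ifs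
    · exact Algebra.commutes _ _
    · simp
  rw [add_mul, mul_add, hz, Finset.sum_mul, Finset.mul_sum, Finset.sum_congr rfl (fun k _ => h k),
    Finset.sum_add_distrib]
  split_ifs <;> simp

theorem comm_zeta_p {P Q : Fin m → Fin n → B} (z : ℂ)
    (pp : ∀ a b i j, P a i * P b j = θ • (P b j * P a i))
    (pq : ∀ a b i j, P a i * Q b j = θ • (Q b j * P a i) + if a = b ∧ i = j then 1 else 0)
    (a b c : Fin m) (i : Fin n) :
    ((if a = b then algebraMap ℂ B z else 0) + ∑ k, Q a k * P b k) * P c i -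
      P c i * ((if a = b then algebraMap ℂ B z else 0) + ∑ k, Q a k * P b k) =
      if a = c then - P b i else 0 := by
  have h : ∀ k, Q a k * P b k * P c i = P c i * (Q a k * P b k) -
      (if a = c then (if k = i then P b k else 0) else 0) := by
    intro k
    rw [← mul_assoc (P c i), pq, mul_assoc, pp b c]
    clear pp pq
    rcases Int.units_eq_one_or θ with rfl | rfl <;>
      (split_ifs <;> simp_all [add_mul, mul_assoc])
  have hz : (if a = b then algebraMap ℂ B z else 0) * P c i =
      P c i * (if a = b then algebraMap ℂ B z else 0) := by
    split_ifs
    · exact Algebra.commutes _ _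
    · simp
  rw [add_mul, mul_add, hz, Finset.sum_mul, Finset.mul_sum, Finset.sum_congr rfl (fun k _ => h k),
    Finset.sum_sub_distrib]
  split_ifs <;> simp

theorem Relations.toPQ (h : Relations p θ E x d) : PQ θ E (coordP p θ x d) (coordQ p x d) := by
  have xx := fun a b i j => sub_eq_zero.1 (h.xx a b i j)
  have dd := fun a b i j => sub_eq_zero.1 (h.dd a b i j)
  have dx := fun a b i j => sub_eq_iff_eq_add'.1 (h.dx a b i j)
  have qq : ∀ a b i j, coordQ p x d a i * coordQ p x d b j =
      θ • (coordQ p x d b j * coordQ p x d a i) := by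
    intro a b i j
    have h1 := dx a b i j
    have h2 := dx b a j i
    by_cases ha : a.val < p <;> by_cases hb : b.val < p <;> simp only [coordQ, ha, hb, if_true, if_false]
    · exact dd a b i j
    · have hab : ¬ (a = b ∧ i = j) := by rintro ⟨rfl, -⟩; exact hb ha
      simpa [hab] using h1
    · have hab : ¬ (b = a ∧ j = i) := by rintro ⟨rfl, -⟩; exact ha hb
      rw [h2]; rcases Int.units_eq_one_or θ with rfl | rfl <;> simp [hab]
    · exact xx a b i j
  have pp : ∀ a b i j, coordP p θ x d a i * coordP p θ x d b j =
      θ • (coordP p θ x d b j * coordP p θ x d a i) := by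
    intro a b i j
    have h1 := dx a b i j
    have h2 := dx b a j i
    by_cases ha : a.val < p <;> by_cases hb : b.val < p <;> simp only [coordP, ha, hb, if_true, if_false]
    · have := xx a b i j
      rcases Int.units_eq_one_or θ with rfl | rfl <;> simpa using this
    · have hab : ¬ (b = a ∧ j = i) := by rintro ⟨rfl, -⟩; exact hb ha
      rcases Int.units_eq_one_or θ with rfl | rfl <;> simp_all
    · have hab : ¬ (a = b ∧ i = j) := by rintro ⟨rfl, -⟩; exact ha hb
      rcases Int.units_eq_one_or θ with rfl | rfl <;> simp_all
    · exact dd a b i j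
  have pq : ∀ a b i j, coordP p θ x d a i * coordQ p x d b j =
      θ • (coordQ p x d b j * coordP p θ x d a i) + if a = b ∧ i = j then 1 else 0 := by
    intro a b i j
    have h1 := dx a b i j
    have h2 := dx b a j i
    by_cases ha : a.val < p <;> by_cases hb : b.val < p <;>
      simp only [coordP, coordQ, ha, hb, if_true, if_false]
    · have : (b = a ∧ j = i) ↔ (a = b ∧ i = j) := by tauto
      rw [if_congr this rfl rfl] at h2
      rw [mul_neg, mul_smul_comm, h2]
      rcases Int.units_eq_one_or θ with rfl | rfl <;> simp
    · have hab : ¬ (a = b ∧ i = j) := by rintro ⟨rfl, -⟩; exact hb ha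
      have := xx a b i j
      clear xx dd dx qq pp h
      rcases Int.units_eq_one_or θ with rfl | rfl <;> simp_all
    · have hab : ¬ (a = b ∧ i = j) := by rintro ⟨rfl, -⟩; exact ha hb
      have := dd a b i j
      clear xx dd dx qq pp h
      rcases Int.units_eq_one_or θ with rfl | rfl <;> simp_all
    · exact h1
  refine ⟨h.EE, qq, pp, pq, ?_, ?_⟩
  · intro a b c i
    rw [← comm_zeta_q (((θ : ℤ) : ℂ) * (n : ℂ) / 2) qq pq a b c i]
    by_cases hc : c.val < p <;> simp only [coordQ, hc, if_true, if_false]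
    · exact h.Ed a b c i
    · exact h.Ex a b c i
  · intro a b c i
    have hz : zeta p θ x d a b * coordP p θ x d c i - coordP p θ x d c i * zeta p θ x d a b =
        if a = c then - coordP p θ x d b i else 0 :=
      comm_zeta_p (((θ : ℤ) : ℂ) * (n : ℂ) / 2) pp pq a b c i
    rw [← hz]
    have hx := h.Ex a b c i
    have hd := h.Ed a b c i
    generalize zeta p θ x d a b = z at hx hd
    by_cases hc : c.val < p <;> simp only [coordP, hc, if_true, if_false] at hx hd ⊢
    · simp only [mul_neg, mul_smul_comm, neg_mul, smul_mul_assoc]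
      rw [← neg_sub', ← neg_sub', ← smul_sub, ← smul_sub, hx]
    · exact hd

/-- `x_{ai}` in terms of the coordinates `p_{ai}`, `q_{ai}`. -/
def ofPQx (p : ℕ) (θ : ℤˣ) (P Q : Fin m → Fin n → B) (a : Fin m) (i : Fin n) : B :=
  if a.val < p then -(θ • P a i) else Q a i

/-- `∂_{ai}` in terms of the coordinates `p_{ai}`, `q_{ai}`. -/
def ofPQd (p : ℕ) (P Q : Fin m → Fin n → B) (a : Fin m) (i : Fin n) : B :=
  if a.val < p then Q a i else P a i

theorem coordP_ofPQ {m n : ℕ} {p : ℕ} {θ : ℤˣ} {B : Type} [Ring B] (P Q : Fin m → Fin n → B) :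
    coordP p θ (ofPQx p θ P Q) (ofPQd p P Q) = P := by
  funext a i
  by_cases ha : a.val < p <;> simp [coordP, ofPQx, ofPQd, ha, smul_smul]

theorem coordQ_ofPQ {m n : ℕ} {p : ℕ} {θ : ℤˣ} {B : Type} [Ring B] (P Q : Fin m → Fin n → B) :
    coordQ p (ofPQx p θ P Q) (ofPQd p P Q) = Q := by
  funext a i
  by_cases ha : a.val < p <;> simp [coordQ, ofPQx, ofPQd, ha]

theorem PQ.toRelations {P Q : Fin m → Fin n → B} (h : PQ θ E P Q) :
    Relations p θ E (ofPQx p θ P Q) (ofPQd p P Q) := by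
  refine ⟨h.EE, ?_, ?_, ?_, ?_, ?_⟩
  · intro a b i j
    have h1 := h.pp a b i j
    have h2 := h.qq a b i j
    have h3 := h.pq a b i j
    have h4 := h.pq b a j i
    clear h
    by_cases ha : a.val < p <;> by_cases hb : b.val < p <;>
      simp only [ofPQx, ha, hb, if_true, if_false]
    · rcases Int.units_eq_one_or θ with rfl | rfl <;> simp_all
    · have hab : ¬ (a = b ∧ i = j) := by rintro ⟨rfl, -⟩; exact hb ha
      rcases Int.units_eq_one_or θ with rfl | rfl <;> simp_all
    · have hab : ¬ (b = a ∧ j = i) := by rintro ⟨rfl, -⟩; exact ha hb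
      rcases Int.units_eq_one_or θ with rfl | rfl <;> simp_all
    · rw [h2, sub_self]
  · intro a b i j
    have h1 := h.pp a b i j
    have h2 := h.qq a b i j
    have h3 := h.pq a b i j
    have h4 := h.pq b a j i
    clear h
    by_cases ha : a.val < p <;> by_cases hb : b.val < p <;>
      simp only [ofPQd, ha, hb, if_true, if_false]
    · rw [h2, sub_self]
    · have hab : ¬ (b = a ∧ j = i) := by rintro ⟨rfl, -⟩; exact hb ha
      rcases Int.units_eq_one_or θ with rfl | rfl <;> simp_all
    · have hab : ¬ (a = b ∧ i = j) := by rintro ⟨rfl, -⟩; exact ha hb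
      rcases Int.units_eq_one_or θ with rfl | rfl <;> simp_all
    · rw [h1, sub_self]
  · intro a b i j
    have h1 := h.pp a b i j
    have h2 := h.qq a b i j
    have h3 := h.pq a b i j
    have h4 := h.pq b a j i
    clear h
    by_cases ha : a.val < p <;> by_cases hb : b.val < p <;>
      simp only [ofPQx, ofPQd, ha, hb, if_true, if_false]
    · have : (b = a ∧ j = i) ↔ (a = b ∧ i = j) := by tauto
      rw [if_congr this rfl rfl] at h4
      rw [neg_mul, smul_mul_assoc, h4]
      rcases Int.units_eq_one_or θ with rfl | rfl <;> simp
    · have hab : ¬ (a = b ∧ i = j) := by rintro ⟨rfl, -⟩; exact hb ha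
      rcases Int.units_eq_one_or θ with rfl | rfl <;> simp_all
    · have hab : ¬ (a = b ∧ i = j) := by rintro ⟨rfl, -⟩; exact ha hb
      rcases Int.units_eq_one_or θ with rfl | rfl <;> simp_all
    · rw [h3, add_sub_cancel_left]
  · intro a b c i
    have hp := (h.Ep a b c i).trans
      (comm_zeta_p (((θ : ℤ) : ℂ) * (n : ℂ) / 2) h.pp h.pq a b c i).symm
    have hq := (h.Eq a b c i).trans
      (comm_zeta_q (((θ : ℤ) : ℂ) * (n : ℂ) / 2) h.qq h.pq a b c i).symm
    unfold zeta
    rw [coordP_ofPQ, coordQ_ofPQ]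
    generalize (if a = b then algebraMap ℂ B (((θ : ℤ) : ℂ) * (n : ℂ) / 2) else 0) +
      ∑ k, Q a k * P b k = z at hp hq ⊢
    by_cases hc : c.val < p <;> simp only [ofPQx, hc, if_true, if_false]
    · simp only [mul_neg, mul_smul_comm, neg_mul, smul_mul_assoc]
      rw [← neg_sub', ← neg_sub', ← smul_sub, ← smul_sub, hp]
    · exact hq
  · intro a b c i
    have hp := (h.Ep a b c i).trans
      (comm_zeta_p (((θ : ℤ) : ℂ) * (n : ℂ) / 2) h.pp h.pq a b c i).symm
    have hq := (h.Eq a b c i).trans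
      (comm_zeta_q (((θ : ℤ) : ℂ) * (n : ℂ) / 2) h.qq h.pq a b c i).symm
    unfold zeta
    rw [coordP_ofPQ, coordQ_ofPQ]
    generalize (if a = b then algebraMap ℂ B (((θ : ℤ) : ℂ) * (n : ℂ) / 2) else 0) +
      ∑ k, Q a k * P b k = z at hp hq ⊢
    by_cases hc : c.val < p <;> simp only [ofPQd, hc, if_true, if_false]
    · exact hq
    · exact hp

end

section
variable (p q n : ℕ) (θ : ℤˣ)

/-- The free algebra on the generators. -/
abbrev Free : Type := FreeAlgebra ℂ (Gen (p + q) n)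

abbrev Free.E (a b : Fin (p + q)) : Free p q n := FreeAlgebra.ι ℂ (Gen.E a b)
abbrev Free.x (a : Fin (p + q)) (i : Fin n) : Free p q n := FreeAlgebra.ι ℂ (Gen.x a i)
abbrev Free.d (a : Fin (p + q)) (i : Fin n) : Free p q n := FreeAlgebra.ι ℂ (Gen.d a i)

/-- The defining relations of `A` as a relation on the free algebra: the relations of `U(gl_m)`,
those of `HD`, and the cross relations `[X, Y] = [ζ(X), Y]`. It is enough to impose the latter for
basis vectors `X` of `gl_m` and generators `Y` of `HD`, since both sides are linear in `X` and
derivations in `Y`. -/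
inductive Rel : Free p q n → Free p q n → Prop
  | EE (a b c e) : Rel (Free.E p q n a b * Free.E p q n c e - Free.E p q n c e * Free.E p q n a b)
      ((if b = c then Free.E p q n a e else 0) - (if a = e then Free.E p q n c b else 0))
  | xx (a b i j) : Rel
      (Free.x p q n a i * Free.x p q n b j - θ • (Free.x p q n b j * Free.x p q n a i)) 0
  | dd (a b i j) : Rel
      (Free.d p q n a i * Free.d p q n b j - θ • (Free.d p q n b j * Free.d p q n a i)) 0
  | dx (a b i j) : Rel
      (Free.d p q n a i * Free.x p q n b j - θ • (Free.x p q n b j * Free.d p q n a i))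
      (if a = b ∧ i = j then 1 else 0)
  | Ex (a b c i) : Rel
      (Free.E p q n a b * Free.x p q n c i - Free.x p q n c i * Free.E p q n a b)
      (zeta p θ (Free.x p q n) (Free.d p q n) a b * Free.x p q n c i -
        Free.x p q n c i * zeta p θ (Free.x p q n) (Free.d p q n) a b)
  | Ed (a b c i) : Rel
      (Free.E p q n a b * Free.d p q n c i - Free.d p q n c i * Free.E p q n a b)
      (zeta p θ (Free.x p q n) (Free.d p q n) a b * Free.d p q n c i -
        Free.d p q n c i * zeta p θ (Free.x p q n) (Free.d p q n) a b)

/-- The algebra `A`, generated by `U(gl_m)` and `HD` subject to the cross relations, `m = p + q`.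
Here `θ = 1` is the case of commuting and `θ = -1` that of anticommuting variables. -/
def A : Type := RingQuot (Rel p q n θ)

instance : Ring (A p q n θ) := inferInstanceAs (Ring (RingQuot (Rel p q n θ)))
instance : Algebra ℂ (A p q n θ) := inferInstanceAs (Algebra ℂ (RingQuot (Rel p q n θ)))

/-- The quotient map onto `A`. -/
def A.mk : Free p q n →ₐ[ℂ] A p q n θ := RingQuot.mkAlgHom ℂ (Rel p q n θ)

/-- The element `E_{ab}` of `A`. -/
def A.E (a b : Fin (p + q)) : A p q n θ := A.mk p q n θ (Free.E p q n a b)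
/-- The element `x_{ai}` of `A`. -/
def A.x (a : Fin (p + q)) (i : Fin n) : A p q n θ := A.mk p q n θ (Free.x p q n a i)
/-- The element `∂_{ai}` of `A`. -/
def A.d (a : Fin (p + q)) (i : Fin n) : A p q n θ := A.mk p q n θ (Free.d p q n a i)
/-- The element `q_{ai}` of `A`. -/
def A.Q (a : Fin (p + q)) (i : Fin n) : A p q n θ := coordQ p (A.x p q n θ) (A.d p q n θ) a i
/-- The element `p_{ai}` of `A`. -/
def A.P (a : Fin (p + q)) (i : Fin n) : A p q n θ := coordP p θ (A.x p q n θ) (A.d p q n θ) a i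

end

section
variable {p q n : ℕ} {θ : ℤˣ}

theorem map_coordQ {m : ℕ} {B C : Type} [Ring B] [Algebra ℂ B] [Ring C] [Algebra ℂ C]
    (f : B →ₐ[ℂ] C) (x d : Fin m → Fin n → B) (a : Fin m) (i : Fin n) :
    f (coordQ p x d a i) = coordQ p (fun a i => f (x a i)) (fun a i => f (d a i)) a i := by
  unfold coordQ; split_ifs <;> rfl

theorem map_smul_unit {B C : Type} [Ring B] [Algebra ℂ B] [Ring C] [Algebra ℂ C]
    (f : B →ₐ[ℂ] C) (u : B) : f (θ • u) = θ • f u := by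
  rcases Int.units_eq_one_or θ with rfl | rfl <;> simp

theorem map_coordP {m : ℕ} {B C : Type} [Ring B] [Algebra ℂ B] [Ring C] [Algebra ℂ C]
    (f : B →ₐ[ℂ] C) (x d : Fin m → Fin n → B) (a : Fin m) (i : Fin n) :
    f (coordP p θ x d a i) = coordP p θ (fun a i => f (x a i)) (fun a i => f (d a i)) a i := by
  unfold coordP; split_ifs <;> simp

theorem map_zeta {m : ℕ} {B C : Type} [Ring B] [Algebra ℂ B] [Ring C] [Algebra ℂ C]
    (f : B →ₐ[ℂ] C) (x d : Fin m → Fin n → B) (a b : Fin m) :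
    f (zeta p θ x d a b) = zeta p θ (fun a i => f (x a i)) (fun a i => f (d a i)) a b := by
  unfold zeta
  simp only [map_add, map_sum, map_mul, map_coordP, map_coordQ]
  split_ifs <;> simp

theorem A.relations : Relations p θ (A.E p q n θ) (A.x p q n θ) (A.d p q n θ) := by
  have key : ∀ u v, Rel p q n θ u v → A.mk p q n θ u = A.mk p q n θ v :=
    fun u v h => RingQuot.mkAlgHom_rel ℂ h
  refine ⟨?_, ?_, ?_, ?_, ?_, ?_⟩
  · intro a b c e
    have := key _ _ (Rel.EE a b c e)
    simp only [map_sub, map_mul] at this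
    unfold A.E
    rw [this]
    split_ifs <;> simp
  · intro a b i j
    have := key _ _ (Rel.xx a b i j)
    simp only [map_sub, map_mul, map_smul_unit, map_zero] at this
    exact this
  · intro a b i j
    have := key _ _ (Rel.dd a b i j)
    simp only [map_sub, map_mul, map_smul_unit, map_zero] at this
    exact this
  · intro a b i j
    have := key _ _ (Rel.dx a b i j)
    simp only [map_sub, map_mul, map_smul_unit] at this
    unfold A.x A.d
    rw [this]
    split_ifs <;> simp
  · intro a b c i
    have := key _ _ (Rel.Ex a b c i)
    simp only [map_sub, map_mul, map_zeta] at this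
    exact this
  · intro a b c i
    have := key _ _ (Rel.Ed a b c i)
    simp only [map_sub, map_mul, map_zeta] at this
    exact this

theorem A.pq : PQ θ (A.E p q n θ) (A.P p q n θ) (A.Q p q n θ) := A.relations.toPQ

/-- The map on generators. -/
def genMap {B : Type} (E : Fin (p + q) → Fin (p + q) → B) (x d : Fin (p + q) → Fin n → B) :
    Gen (p + q) n → B
  | .E a b => E a b
  | .x a i => x a i
  | .d a i => d a i

/-- Algebra homomorphisms out of `A`. -/
def A.lift {B : Type} [Ring B] [Algebra ℂ B] {E : Fin (p + q) → Fin (p + q) → B}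
    {x d : Fin (p + q) → Fin n → B} (h : Relations p θ E x d) : A p q n θ →ₐ[ℂ] B :=
  RingQuot.liftAlgHom ℂ ⟨FreeAlgebra.lift ℂ (genMap E x d), by
    have hE : ∀ a b, FreeAlgebra.lift ℂ (genMap E x d) (FreeAlgebra.ι ℂ (Gen.E a b)) = E a b :=
      fun a b => by simp [genMap]
    have hx : ∀ a b, FreeAlgebra.lift ℂ (genMap E x d) (FreeAlgebra.ι ℂ (Gen.x a b)) = x a b :=
      fun a b => by simp [genMap]
    have hd : ∀ a b, FreeAlgebra.lift ℂ (genMap E x d) (FreeAlgebra.ι ℂ (Gen.d a b)) = d a b :=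
      fun a b => by simp [genMap]
    intro u v huv
    induction huv with
    | EE a b c e =>
      simp only [map_sub, map_mul, hE, h.EE]
      split_ifs <;> simp [hE]
    | xx a b i j => simpa only [map_sub, map_mul, map_smul_unit, map_zero, hx] using h.xx a b i j
    | dd a b i j => simpa only [map_sub, map_mul, map_smul_unit, map_zero, hd] using h.dd a b i j
    | dx a b i j =>
      simp only [map_sub, map_mul, map_smul_unit, hx, hd, h.dx]
      split_ifs <;> simp
    | Ex a b c i => simpa only [map_sub, map_mul, map_zeta, hE, hx, hd] using h.Ex a b c i
    | Ed a b c i => simpa only [map_sub, map_mul, map_zeta, hE, hx, hd] using h.Ed a b c i⟩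

section
variable {B : Type} [Ring B] [Algebra ℂ B] {E : Fin (p + q) → Fin (p + q) → B}
    {x d : Fin (p + q) → Fin n → B} (h : Relations p θ E x d)

theorem A.lift_mk (u : Free p q n) :
    A.lift h (A.mk p q n θ u) = FreeAlgebra.lift ℂ (genMap E x d) u :=
  RingQuot.liftAlgHom_mkAlgHom_apply ℂ _ _ u

theorem A.lift_E (a b : Fin (p + q)) : A.lift h (A.E p q n θ a b) = E a b := by
  simp [A.E, A.lift_mk, genMap]

theorem A.lift_x (a : Fin (p + q)) (i : Fin n) : A.lift h (A.x p q n θ a i) = x a i := by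
  simp [A.x, A.lift_mk, genMap]

theorem A.lift_d (a : Fin (p + q)) (i : Fin n) : A.lift h (A.d p q n θ a i) = d a i := by
  simp [A.d, A.lift_mk, genMap]

theorem A.lift_Q (a : Fin (p + q)) (i : Fin n) :
    A.lift h (A.Q p q n θ a i) = coordQ p x d a i := by
  simp [A.Q, map_coordQ, A.lift_x, A.lift_d]

theorem A.lift_P (a : Fin (p + q)) (i : Fin n) :
    A.lift h (A.P p q n θ a i) = coordP p θ x d a i := by
  simp [A.P, map_coordP, A.lift_x, A.lift_d]

end

/-- Induction over `A`. -/
theorem A.induction {C : A p q n θ → Prop} (hs : ∀ z, C (algebraMap ℂ _ z))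
    (hE : ∀ a b, C (A.E p q n θ a b)) (hP : ∀ a i, C (A.P p q n θ a i))
    (hQ : ∀ a i, C (A.Q p q n θ a i)) (hn : ∀ u, C u → C (-u))
    (hadd : ∀ u v, C u → C v → C (u + v)) (hmul : ∀ u v, C u → C v → C (u * v))
    (u : A p q n θ) : C u := by
  obtain ⟨u, rfl⟩ := RingQuot.mkAlgHom_surjective ℂ (Rel p q n θ) u
  have hx : ∀ a i, C (A.x p q n θ a i) := by
    intro a i
    have h1 := hP a i
    have h2 := hQ a i
    have h3 := hn _ h1
    by_cases ha : a.val < p <;> simp only [A.P, A.Q, coordP, coordQ, ha, if_true, if_false] at h1 h2 h3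
    · rcases Int.units_eq_one_or θ with rfl | rfl <;> simp_all
    · exact h2
  have hd : ∀ a i, C (A.d p q n θ a i) := by
    intro a i
    have h1 := hP a i
    have h2 := hQ a i
    by_cases ha : a.val < p <;> simp only [A.P, A.Q, coordP, coordQ, ha, if_true, if_false] at h1 h2
    · exact h2
    · exact h1
  induction u using FreeAlgebra.induction with
  | grade0 z => rw [AlgHom.commutes]; exact hs z
  | grade1 g =>
    rcases g with ⟨a, b⟩ | ⟨a, b⟩ | ⟨a, b⟩
    · exact hE a b
    · exact hx a b
    · exact hd a b
  | mul u v hu hv => rw [map_mul]; exact hmul _ _ hu hv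
  | add u v hu hv => rw [map_add]; exact hadd _ _ hu hv

/-- The permuted generators satisfy the defining relations. -/
theorem A.permRelations (σ : Equiv.Perm (Fin (p + q))) :
    Relations p θ (fun a b => A.E p q n θ (σ a) (σ b))
      (ofPQx p θ (fun a i => A.P p q n θ (σ a) i) (fun a i => A.Q p q n θ (σ a) i))
      (ofPQd p (fun a i => A.P p q n θ (σ a) i) (fun a i => A.Q p q n θ (σ a) i)) := by
  apply PQ.toRelations
  have h := A.pq (p := p) (q := q) (n := n) (θ := θ)
  constructor
  · intro a b c e; simp [h.EE]
  · intro a b i j; exact h.qq _ _ _ _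
  · intro a b i j; exact h.pp _ _ _ _
  · intro a b i j; rw [h.pq]; simp
  · intro a b c i; rw [h.Eq]; simp
  · intro a b c i; rw [h.Ep]; simp

/-- The action of `σ` on `A`: it maps `E_{ab}`, `p_{ai}`, `q_{ai}` to `E_{σ(a)σ(b)}`, `p_{σ(a)i}`,
`q_{σ(a)i}`. -/
def A.perm (σ : Equiv.Perm (Fin (p + q))) : A p q n θ →ₐ[ℂ] A p q n θ :=
  A.lift (A.permRelations σ)

theorem A.perm_E (σ : Equiv.Perm (Fin (p + q))) (a b : Fin (p + q)) :
    A.perm σ (A.E p q n θ a b) = A.E p q n θ (σ a) (σ b) := A.lift_E _ a b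

theorem A.perm_P (σ : Equiv.Perm (Fin (p + q))) (a : Fin (p + q)) (i : Fin n) :
    A.perm σ (A.P p q n θ a i) = A.P p q n θ (σ a) i := by
  rw [A.perm, A.lift_P, coordP_ofPQ]

theorem A.perm_Q (σ : Equiv.Perm (Fin (p + q))) (a : Fin (p + q)) (i : Fin n) :
    A.perm σ (A.Q p q n θ a i) = A.Q p q n θ (σ a) i := by
  rw [A.perm, A.lift_Q, coordQ_ofPQ]

end

section
variable {p q n : ℕ} {θ : ℤˣ}

theorem A.cartan_comm : ∀ u ∈ Set.range (fun a => A.E p q n θ a a),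
    ∀ v ∈ Set.range (fun a => A.E p q n θ a a), u * v = v * u := by
  rintro _ ⟨a, rfl⟩ _ ⟨b, rfl⟩
  have := A.relations.EE (E := A.E p q n θ) a a b b
  by_cases h : a = b
  · subst h; rfl
  · simpa [h, Ne.symm h, sub_eq_zero] using this

open scoped IsMulCommutative in
/-- The homomorphism `U(h) → A`, where `U(h)` is the polynomial algebra in the commuting variables
`E_{aa}` (the variable `X a` stands for `E_{aa}`). -/
def A.ofPoly : MvPolynomial (Fin (p + q)) ℂ →ₐ[ℂ] A p q n θ :=
  haveI : IsMulCommutative (Algebra.adjoin ℂ (Set.range (fun a => A.E p q n θ a a))) :=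
    Algebra.isMulCommutative_adjoin ℂ A.cartan_comm
  (Algebra.adjoin ℂ (Set.range (fun a => A.E p q n θ a a))).val.comp
    (MvPolynomial.aeval (S₁ := Algebra.adjoin ℂ (Set.range (fun a => A.E p q n θ a a)))
      (fun a => ⟨A.E p q n θ a a, Algebra.subset_adjoin ⟨a, rfl⟩⟩))

theorem A.ofPoly_X (a : Fin (p + q)) :
    A.ofPoly (MvPolynomial.X a) = A.E p q n θ a a := by
  simp [A.ofPoly]

/-- For `f` in `U(h)` and an integral weight `η`, the polynomial function `μ ↦ f (μ + η)`. -/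
def shift {m : ℕ} (η : Fin m → ℤ) : MvPolynomial (Fin m) ℂ →ₐ[ℂ] MvPolynomial (Fin m) ℂ :=
  MvPolynomial.aeval (fun a => MvPolynomial.X a + MvPolynomial.C (η a : ℂ))

/-- The multiplicative set generated by `E_{aa} - E_{bb} + z` for `a ≠ b` and `z ∈ ℤ`. -/
def denomPoly (m : ℕ) : Submonoid (MvPolynomial (Fin m) ℂ) :=
  Submonoid.closure {f | ∃ a b : Fin m, a ≠ b ∧ ∃ z : ℤ,
    f = MvPolynomial.X a - MvPolynomial.X b + MvPolynomial.C (z : ℂ)}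

/-- The denominators, as elements of `A`. -/
def denom (p q n : ℕ) (θ : ℤˣ) : Submonoid (A p q n θ) :=
  (denomPoly (p + q)).map (A.ofPoly (p := p) (q := q) (n := n) (θ := θ))

theorem shift_mem {m : ℕ} (η : Fin m → ℤ) {f : MvPolynomial (Fin m) ℂ} (hf : f ∈ denomPoly m) :
    shift η f ∈ denomPoly m := by
  induction hf using Submonoid.closure_induction with
  | mem f h =>
    obtain ⟨a, b, hab, z, rfl⟩ := h
    refine Submonoid.subset_closure ⟨a, b, hab, z + η a - η b, ?_⟩
    simp [shift]
    ring
  | one => rw [map_one]; exact one_mem _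
  | mul f g _ _ hf hg => rw [map_mul]; exact mul_mem hf hg

theorem shift_neg {m : ℕ} (η : Fin m → ℤ) (f : MvPolynomial (Fin m) ℂ) :
    shift η (shift (-η) f) = f := by
  have : (shift η).comp (shift (-η)) = AlgHom.id ℂ (MvPolynomial (Fin m) ℂ) := by
    ext a; simp [shift]
  exact DFunLike.congr_fun this f

/-- `u` has weight `η` under the adjoint action of `h`. -/
def A.HasWeight (η : Fin (p + q) → ℤ) (u : A p q n θ) : Prop :=
  ∀ a, A.E p q n θ a a * u - u * A.E p q n θ a a = (η a : ℂ) • u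

theorem A.HasWeight.poly_mul {η : Fin (p + q) → ℤ} {u : A p q n θ} (h : A.HasWeight η u)
    (f : MvPolynomial (Fin (p + q)) ℂ) :
    A.ofPoly f * u = u * A.ofPoly (shift η f) := by
  induction f using MvPolynomial.induction_on with
  | C z =>
    have : (MvPolynomial.C z : MvPolynomial (Fin (p + q)) ℂ) = algebraMap ℂ _ z := rfl
    rw [this, AlgHom.commutes, AlgHom.commutes, AlgHom.commutes]; exact Algebra.commutes _ _
  | add f g hf hg => rw [map_add, map_add, map_add, add_mul, mul_add, hf, hg]
  | mul_X f a hf =>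
    rw [map_mul, map_mul, map_mul, mul_assoc, A.ofPoly_X]
    have := sub_eq_iff_eq_add'.1 (h a)
    rw [this, mul_add, mul_smul_comm, ← mul_assoc, hf]
    have hs : A.ofPoly (shift η (MvPolynomial.X a)) =
        A.E p q n θ a a + algebraMap ℂ _ (η a : ℂ) := by
      have : (MvPolynomial.C (η a : ℂ) : MvPolynomial (Fin (p + q)) ℂ) = algebraMap ℂ _ _ := rfl
      rw [shift, MvPolynomial.aeval_X, map_add, A.ofPoly_X, this, AlgHom.commutes]
    rw [hs, mul_add, mul_add, mul_assoc, ← Algebra.commutes (η a : ℂ) (A.ofPoly (shift η f)),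
      ← Algebra.smul_def, mul_smul_comm]

theorem A.HasWeight.mul_poly {η : Fin (p + q) → ℤ} {u : A p q n θ} (h : A.HasWeight η u)
    (f : MvPolynomial (Fin (p + q)) ℂ) :
    u * A.ofPoly f = A.ofPoly (shift (-η) f) * u := by
  rw [h.poly_mul, shift_neg]

theorem A.HasWeight.mul {η κ : Fin (p + q) → ℤ} {u v : A p q n θ} (hu : A.HasWeight η u)
    (hv : A.HasWeight κ v) : A.HasWeight (η + κ) (u * v) := by
  intro a
  have h1 := hu a
  have h2 := hv a
  have : A.E p q n θ a a * (u * v) - u * v * A.E p q n θ a a =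
      (A.E p q n θ a a * u - u * A.E p q n θ a a) * v +
        u * (A.E p q n θ a a * v - v * A.E p q n θ a a) := by noncomm_ring
  rw [this, h1, h2]
  simp [add_smul]

theorem A.hasWeight_E (a b : Fin (p + q)) :
    A.HasWeight (Pi.single a 1 - Pi.single b 1) (A.E p q n θ a b) := by
  intro c
  rw [A.relations.EE]
  have e : (if c = a then A.E p q n θ c b else 0) - (if c = b then A.E p q n θ a c else 0) =
      (((if c = a then 1 else 0) - (if c = b then 1 else 0) : ℤ) : ℂ) • A.E p q n θ a b := by
    by_cases h1 : c = a
    · subst h1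
      by_cases h2 : c = b
      · subst h2; simp
      · simp [h2]
    · by_cases h2 : c = b
      · subst h2; simp [h1]
      · simp [h1, h2]
  rw [e]
  simp [Pi.single_apply]

theorem A.hasWeight_Q (a : Fin (p + q)) (i : Fin n) :
    A.HasWeight (Pi.single a 1) (A.Q p q n θ a i) := by
  intro c
  rw [A.pq.Eq]
  by_cases h1 : c = a <;> simp [h1]

theorem A.hasWeight_P (a : Fin (p + q)) (i : Fin n) :
    A.HasWeight (-Pi.single a 1) (A.P p q n θ a i) := by
  intro c
  rw [A.pq.Ep]
  by_cases h1 : c = a <;> simp [h1]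

/-- Every element of `A` is a sum of weight vectors. -/
theorem A.weight_induction {C : A p q n θ → Prop} (hw : ∀ η u, A.HasWeight η u → C u)
    (hadd : ∀ u v, C u → C v → C (u + v)) (u : A p q n θ) : C u := by
  have h0 : ∀ z, A.HasWeight 0 (algebraMap ℂ (A p q n θ) z) := by
    intro z a; simp [Algebra.commutes]
  suffices h : u ∈ AddSubmonoid.closure {u : A p q n θ | ∃ η, A.HasWeight η u} by
    induction h using AddSubmonoid.closure_induction with
    | mem u h => exact hw _ _ h.choose_spec
    | zero => exact hw 0 0 (by simpa using h0 0)
    | add u v _ _ hu hv => exact hadd u v hu hv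
  induction u using A.induction with
  | hs z => exact AddSubmonoid.subset_closure ⟨0, h0 z⟩
  | hE a b => exact AddSubmonoid.subset_closure ⟨_, A.hasWeight_E a b⟩
  | hP a i => exact AddSubmonoid.subset_closure ⟨_, A.hasWeight_P a i⟩
  | hQ a i => exact AddSubmonoid.subset_closure ⟨_, A.hasWeight_Q a i⟩
  | hadd u v hu hv => exact add_mem hu hv
  | hn u hu =>
    induction hu using AddSubmonoid.closure_induction with
    | mem u h =>
      obtain ⟨η, h⟩ := h
      refine AddSubmonoid.subset_closure ⟨η, fun a => ?_⟩
      rw [smul_neg, ← h a]; noncomm_ring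
    | zero => simp
    | add u v _ _ hu hv => rw [neg_add]; exact add_mem hu hv
  | hmul u v hu hv =>
    induction hu using AddSubmonoid.closure_induction with
    | zero => simp
    | add u w _ _ hu hw => rw [add_mul]; exact add_mem hu hw
    | mem u h =>
      induction hv using AddSubmonoid.closure_induction with
      | zero => simp
      | add v w _ _ hv hw => rw [mul_add]; exact add_mem hv hw
      | mem v h' =>
        exact AddSubmonoid.subset_closure ⟨_, h.choose_spec.mul h'.choose_spec⟩

/-- The Ore condition. -/
theorem A.ore_condition (u : A p q n θ) : ∀ f ∈ denomPoly (p + q),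
    ∃ g ∈ denomPoly (p + q), ∃ v : A p q n θ, A.ofPoly g * u = v * A.ofPoly f := by
  induction u using A.weight_induction with
  | hw η u h => exact fun f hf => ⟨_, shift_mem (-η) hf, u, (h.mul_poly f).symm⟩
  | hadd u v hu hv =>
    intro f hf
    obtain ⟨g, hg, w, h1⟩ := hu f hf
    obtain ⟨g', hg', w', h2⟩ := hv f hf
    refine ⟨g * g', mul_mem hg hg', A.ofPoly g' * w + A.ofPoly g * w', ?_⟩
    rw [mul_add, add_mul, mul_assoc, mul_assoc, ← h1, ← h2, ← mul_assoc, ← mul_assoc, ← map_mul,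
      ← map_mul, mul_comm g']

/-- The cancellation part of the Ore condition. -/
theorem A.ore_cancel (u : A p q n θ) {f : MvPolynomial (Fin (p + q)) ℂ}
    (hf : f ∈ denomPoly (p + q)) (h : u * A.ofPoly f = 0) :
    ∃ g ∈ denomPoly (p + q), A.ofPoly g * u = 0 := by
  induction hf using Submonoid.closure_induction generalizing u with
  | one => exact ⟨1, one_mem _, by simpa using h⟩
  | mul f f' _ _ hf hf' =>
    rw [mul_comm, map_mul, ← mul_assoc] at h
    obtain ⟨g, hg, h⟩ := hf _ h
    rw [← mul_assoc] at h
    obtain ⟨g', hg', h⟩ := hf' _ h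
    exact ⟨g' * g, mul_mem hg' hg, by rw [map_mul, mul_assoc, h]⟩
  | mem f hf =>
    obtain ⟨a, b, hab, z, rfl⟩ := hf
    set H : A p q n θ := A.ofPoly (MvPolynomial.X a - MvPolynomial.X b + MvPolynomial.C (z : ℂ))
      with hH
    -- the adjoint action of `H` is annihilated by a product of operators `ad H - k`
    let L : Module.End ℂ (A p q n θ) := LinearMap.mulLeft ℂ H - LinearMap.mulRight ℂ H
    have key : ∀ v : A p q n θ, ∃ l : List ℤ,
        (l.map (fun k : ℤ => L - algebraMap ℂ (Module.End ℂ (A p q n θ)) (k : ℂ))).prod v = 0 := by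
      intro v
      induction v using A.weight_induction with
      | hw η v hv =>
        refine ⟨[η a - η b], ?_⟩
        have := hv.poly_mul (MvPolynomial.X a - MvPolynomial.X b + MvPolynomial.C (z : ℂ))
        have e : shift η (MvPolynomial.X a - MvPolynomial.X b + MvPolynomial.C (z : ℂ)) =
          (MvPolynomial.X a - MvPolynomial.X b + MvPolynomial.C (z : ℂ)) +
            algebraMap ℂ _ ((η a : ℂ) - η b) := by
          simp [shift]; ring
        rw [e, map_add _ _ (algebraMap _ _ _), AlgHom.commutes, ← hH, mul_add, ← Algebra.commutes] at this
        simp [L, this, Algebra.smul_def, sub_mul]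
      | hadd v w hv hw =>
        obtain ⟨l, hl⟩ := hv
        obtain ⟨l', hl'⟩ := hw
        refine ⟨l ++ l', ?_⟩
        have comm : Commute
            (l.map (fun k : ℤ => L - algebraMap ℂ (Module.End ℂ (A p q n θ)) (k : ℂ))).prod
            (l'.map (fun k : ℤ => L - algebraMap ℂ (Module.End ℂ (A p q n θ)) (k : ℂ))).prod := by
          apply Commute.list_prod_left
          intro x hx
          apply Commute.list_prod_right
          intro y hy
          obtain ⟨k, -, rfl⟩ := List.mem_map.1 hx
          obtain ⟨k', -, rfl⟩ := List.mem_map.1 hy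
          exact ((Commute.refl L).sub_left (Algebra.commutes _ _)).sub_right
            (Algebra.commutes _ _).symm
        rw [List.map_append, List.prod_append, map_add]
        nth_rewrite 1 [comm.eq]
        rw [Module.End.mul_apply, Module.End.mul_apply, hl, hl', map_zero, map_zero, add_zero]
    obtain ⟨l, hl⟩ := key u
    -- on elements killed by right multiplication by `H`, the operator `ad H - k` is left
    -- multiplication by `H - k`
    have key2 : ∀ l : List ℤ, ∃ g ∈ denomPoly (p + q), ∀ v : A p q n θ, v * H = 0 →
        (l.map (fun k : ℤ => L - algebraMap ℂ (Module.End ℂ (A p q n θ)) (k : ℂ))).prod v =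
          A.ofPoly g * v := by
      intro l
      induction l with
      | nil => exact ⟨1, one_mem _, by simp⟩
      | cons k l ih =>
        obtain ⟨g, hg, h2⟩ := ih
        refine ⟨(MvPolynomial.X a - MvPolynomial.X b + MvPolynomial.C ((z - k : ℤ) : ℂ)) * g,
          mul_mem (Submonoid.subset_closure ⟨a, b, hab, _, rfl⟩) hg, fun v hv => ?_⟩
        have e : (MvPolynomial.X a - MvPolynomial.X b + MvPolynomial.C ((z - k : ℤ) : ℂ) :
            MvPolynomial (Fin (p + q)) ℂ) =
            (MvPolynomial.X a - MvPolynomial.X b + MvPolynomial.C (z : ℂ)) -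
            algebraMap ℂ _ (k : ℂ) := by
          have : ∀ z, (algebraMap ℂ (MvPolynomial (Fin (p + q)) ℂ) z) = MvPolynomial.C z :=
            fun z => rfl
          rw [this]; push_cast; rw [map_sub]; ring
        rw [List.map_cons, List.prod_cons, Module.End.mul_apply, h2 v hv, e,
          map_mul A.ofPoly, map_sub A.ofPoly _ (algebraMap _ _ _), AlgHom.commutes, ← hH]
        simp [L, sub_mul, mul_assoc, hv, Algebra.smul_def]
    obtain ⟨g, hg, h2⟩ := key2 l
    exact ⟨g, hg, by rw [← h2 u h, hl]⟩

theorem A.nonempty_oreSet : Nonempty (OreLocalization.OreSet (denom p q n θ)) := by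
  rw [OreLocalization.nonempty_oreSet_iff]
  constructor
  · rintro u v ⟨_, f, hf, rfl⟩ h
    obtain ⟨g, hg, h⟩ := A.ore_cancel (u - v) hf (by simpa [sub_mul, sub_eq_zero] using h)
    exact ⟨⟨_, g, hg, rfl⟩, by simpa [mul_sub, sub_eq_zero] using h⟩
  · rintro u ⟨_, f, hf, rfl⟩
    obtain ⟨g, hg, v, h⟩ := A.ore_condition u f hf
    exact ⟨v, ⟨_, g, hg, rfl⟩, h⟩

/-- `A` satisfies the Ore condition relative to the denominators. -/
instance : OreLocalization.OreSet (denom p q n θ) := A.nonempty_oreSet.some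

end

/-- The ring of fractions of `A` relative to the set of denominators. -/
abbrev Ab (p q n : ℕ) (θ : ℤˣ) : Type := OreLocalization (denom p q n θ) (A p q n θ)

section
variable {p q n : ℕ} {θ : ℤˣ}

/-- The canonical homomorphism `A → Ab`. -/
def Ab.of : A p q n θ →ₐ[ℂ] Ab p q n θ :=
  { OreLocalization.numeratorRingHom (S := denom p q n θ) with commutes' := fun _ => rfl }

theorem Ab.of_apply (u : A p q n θ) : Ab.of u = u /ₒ (1 : denom p q n θ) := rfl

theorem mem_denom {f : MvPolynomial (Fin (p + q)) ℂ} (hf : f ∈ denomPoly (p + q)) :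
    A.ofPoly f ∈ denom p q n θ := ⟨f, hf, rfl⟩

/-- The homomorphism `U(h) → Ab`. -/
def Ab.poly : MvPolynomial (Fin (p + q)) ℂ →ₐ[ℂ] Ab p q n θ := Ab.of.comp A.ofPoly

theorem Ab.poly_apply (f : MvPolynomial (Fin (p + q)) ℂ) :
    (Ab.poly f : Ab p q n θ) = Ab.of (A.ofPoly f) := rfl

theorem Ab.isUnit_poly {f : MvPolynomial (Fin (p + q)) ℂ} (hf : f ∈ denomPoly (p + q)) :
    IsUnit (Ab.poly f : Ab p q n θ) :=
  OreLocalization.numerator_isUnit (⟨A.ofPoly f, mem_denom hf⟩ : denom p q n θ)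

/-- The inverse in `Ab` of an element of `U(h)` (meaningful for denominators only). -/
def Ab.inv (f : MvPolynomial (Fin (p + q)) ℂ) : Ab p q n θ := Ring.inverse (Ab.poly f)

theorem Ab.inv_mul {f : MvPolynomial (Fin (p + q)) ℂ} (hf : f ∈ denomPoly (p + q)) :
    Ab.inv f * Ab.poly f = (1 : Ab p q n θ) := Ring.inverse_mul_cancel _ (Ab.isUnit_poly hf)

theorem Ab.mul_inv {f : MvPolynomial (Fin (p + q)) ℂ} (hf : f ∈ denomPoly (p + q)) :
    Ab.poly f * Ab.inv f = (1 : Ab p q n θ) := Ring.mul_inverse_cancel _ (Ab.isUnit_poly hf)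

theorem Ab.exists_rep (y : Ab p q n θ) : ∃ f ∈ denomPoly (p + q), ∃ Y : A p q n θ,
    y = Ab.inv f * Ab.of Y := by
  induction y using OreLocalization.ind with
  | c r s =>
    obtain ⟨_, f, hf, rfl⟩ := s
    refine ⟨f, hf, r, ?_⟩
    have : Ab.poly f * (r /ₒ (⟨A.ofPoly f, mem_denom hf⟩ : denom p q n θ)) = Ab.of r :=
      OreLocalization.mul_cancel (s := ⟨A.ofPoly f, mem_denom hf⟩) (t := 1)
    change r /ₒ (⟨A.ofPoly f, mem_denom hf⟩ : denom p q n θ) = Ab.inv f * Ab.of r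
    rw [← this, ← mul_assoc, Ab.inv_mul hf, one_mul]

theorem Ab.of_eq {u v : A p q n θ} (h : Ab.of u = Ab.of v) :
    ∃ f ∈ denomPoly (p + q), A.ofPoly f * u = A.ofPoly f * v := by
  rw [Ab.of_apply, Ab.of_apply] at h
  obtain ⟨⟨g, hg⟩, w, h1, h2⟩ := OreLocalization.oreDiv_eq_iff.1 h
  obtain ⟨f, hf, rfl⟩ := hg
  refine ⟨f, hf, ?_⟩
  simp only [OneMemClass.coe_one, mul_one] at h2
  rw [← h2] at h1
  exact h1.symm

theorem Ab.inv_comm_poly {f : MvPolynomial (Fin (p + q)) ℂ} (hf : f ∈ denomPoly (p + q))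
    (g : MvPolynomial (Fin (p + q)) ℂ) :
    (Ab.inv f * Ab.poly g : Ab p q n θ) = Ab.poly g * Ab.inv f := by
  have h : (Ab.poly f * Ab.poly g : Ab p q n θ) = Ab.poly g * Ab.poly f := by
    rw [← map_mul, mul_comm, map_mul]
  calc (Ab.inv f * Ab.poly g : Ab p q n θ)
      = Ab.inv f * Ab.poly g * (Ab.poly f * Ab.inv f) := by rw [Ab.mul_inv hf, mul_one]
    _ = Ab.inv f * (Ab.poly g * Ab.poly f) * Ab.inv f := by noncomm_ring
    _ = Ab.poly g * Ab.inv f := by rw [← h, ← mul_assoc, Ab.inv_mul hf, one_mul]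

theorem Ab.inv_mul_inv {f g : MvPolynomial (Fin (p + q)) ℂ} (hf : f ∈ denomPoly (p + q))
    (hg : g ∈ denomPoly (p + q)) :
    (Ab.inv (f * g) : Ab p q n θ) = Ab.inv f * Ab.inv g := by
  have h1 := Ab.inv_mul (n := n) (θ := θ) (mul_mem hf hg)
  calc (Ab.inv (f * g) : Ab p q n θ)
      = Ab.inv (f * g) * (Ab.poly f * (Ab.poly g * Ab.inv g) * Ab.inv f) := by
        rw [Ab.mul_inv hg, mul_one, Ab.mul_inv hf, mul_one]
    _ = Ab.inv (f * g) * Ab.poly (f * g) * Ab.inv g * Ab.inv f := by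
        rw [map_mul]; noncomm_ring
    _ = Ab.inv g * Ab.inv f := by rw [h1, one_mul]
    _ = Ab.inv g * Ab.inv f * (Ab.poly g * Ab.inv g) := by rw [Ab.mul_inv hg, mul_one]
    _ = Ab.inv g * (Ab.inv f * Ab.poly g) * Ab.inv g := by noncomm_ring
    _ = Ab.inv f * Ab.inv g := by
        rw [Ab.inv_comm_poly hf, ← mul_assoc, Ab.inv_mul hg, one_mul]

theorem Ab.weight_mul_poly {η : Fin (p + q) → ℤ} {u : A p q n θ} (h : A.HasWeight η u)
    (f : MvPolynomial (Fin (p + q)) ℂ) :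
    Ab.poly f * Ab.of u = Ab.of u * Ab.poly (shift η f) := by
  rw [Ab.poly_apply, Ab.poly_apply, ← map_mul, ← map_mul, h.poly_mul]

theorem Ab.inv_weight {η : Fin (p + q) → ℤ} {u : A p q n θ} (h : A.HasWeight η u)
    {f : MvPolynomial (Fin (p + q)) ℂ} (hf : f ∈ denomPoly (p + q)) :
    Ab.inv f * Ab.of u = Ab.of u * Ab.inv (shift η f) := by
  have h1 := Ab.weight_mul_poly h f
  have h2 := Ab.mul_inv (n := n) (θ := θ) (shift_mem η hf)
  calc Ab.inv f * Ab.of u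
      = Ab.inv f * Ab.of u * (Ab.poly (shift η f) * Ab.inv (shift η f)) := by rw [h2, mul_one]
    _ = Ab.inv f * (Ab.of u * Ab.poly (shift η f)) * Ab.inv (shift η f) := by noncomm_ring
    _ = _ := by rw [← h1, ← mul_assoc, Ab.inv_mul hf, one_mul]

/-- The automorphism of `U(h)` defined by a permutation. -/
def permPoly {m : ℕ} (σ : Equiv.Perm (Fin m)) :
    MvPolynomial (Fin m) ℂ →ₐ[ℂ] MvPolynomial (Fin m) ℂ := MvPolynomial.rename σ

theorem permPoly_mem {m : ℕ} (σ : Equiv.Perm (Fin m)) {f : MvPolynomial (Fin m) ℂ}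
    (hf : f ∈ denomPoly m) : permPoly σ f ∈ denomPoly m := by
  induction hf using Submonoid.closure_induction with
  | mem f h =>
    obtain ⟨a, b, hab, z, rfl⟩ := h
    refine Submonoid.subset_closure ⟨σ a, σ b, by simpa using hab, z, ?_⟩
    simp [permPoly]
  | one => rw [map_one]; exact one_mem _
  | mul f g _ _ hf hg => rw [map_mul]; exact mul_mem hf hg

theorem A.perm_ofPoly (σ : Equiv.Perm (Fin (p + q))) (f : MvPolynomial (Fin (p + q)) ℂ) :
    A.perm σ (A.ofPoly f : A p q n θ) = A.ofPoly (permPoly σ f) := by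
  have : ((A.perm σ).comp A.ofPoly : _ →ₐ[ℂ] A p q n θ) = A.ofPoly.comp (permPoly σ) := by
    ext a; simp [permPoly, A.ofPoly_X, A.perm_E]
  exact DFunLike.congr_fun this f

theorem Ab.isUnit_of_perm (σ : Equiv.Perm (Fin (p + q))) (s : denom p q n θ) :
    IsUnit (Ab.of (A.perm σ (s : A p q n θ))) := by
  obtain ⟨_, f, hf, rfl⟩ := s
  change IsUnit (Ab.of (A.perm σ (A.ofPoly f : A p q n θ)))
  rw [A.perm_ofPoly]
  exact Ab.isUnit_poly (permPoly_mem σ hf)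

/-- The action of a permutation `σ` on `Ab`, extending the action on `A`. -/
def Ab.perm (σ : Equiv.Perm (Fin (p + q))) : Ab p q n θ →ₐ[ℂ] Ab p q n θ :=
  { OreLocalization.universalHom (S := denom p q n θ)
      ((Ab.of.comp (A.perm σ) : A p q n θ →ₐ[ℂ] Ab p q n θ) : A p q n θ →+* Ab p q n θ)
      (IsUnit.liftRight
        (((Ab.of.comp (A.perm σ) : A p q n θ →ₐ[ℂ] Ab p q n θ) : A p q n θ →* Ab p q n θ).comp
          (denom p q n θ).subtype) (Ab.isUnit_of_perm σ))
      (fun _ => rfl) with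
    commutes' := fun z => by
      have := OreLocalization.universalHom_commutes (S := denom p q n θ)
        ((Ab.of.comp (A.perm σ) : A p q n θ →ₐ[ℂ] Ab p q n θ) : A p q n θ →+* Ab p q n θ)
        (IsUnit.liftRight
        (((Ab.of.comp (A.perm σ) : A p q n θ →ₐ[ℂ] Ab p q n θ) : A p q n θ →* Ab p q n θ).comp
          (denom p q n θ).subtype) (Ab.isUnit_of_perm σ)) (fun _ => rfl)
        (r := algebraMap ℂ (A p q n θ) z)
      exact this.trans ((Ab.of.comp (A.perm σ)).commutes z) }

theorem Ab.perm_of (σ : Equiv.Perm (Fin (p + q))) (u : A p q n θ) :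
    Ab.perm σ (Ab.of u) = Ab.of (A.perm σ u) :=
  OreLocalization.universalHom_commutes (S := denom p q n θ)
    ((Ab.of.comp (A.perm σ) : A p q n θ →ₐ[ℂ] Ab p q n θ) : A p q n θ →+* Ab p q n θ)
    (IsUnit.liftRight
      (((Ab.of.comp (A.perm σ) : A p q n θ →ₐ[ℂ] Ab p q n θ) : A p q n θ →* Ab p q n θ).comp
        (denom p q n θ).subtype) (Ab.isUnit_of_perm σ)) (fun _ => rfl)

/-- The right ideal `Jb` of `Ab` generated by `n`, i.e. by the elements `E_{ba}` with `a < b`. -/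
def Jb (p q n : ℕ) (θ : ℤˣ) : Submodule ℂ (Ab p q n θ) :=
  (Submodule.span (Ab p q n θ)ᵐᵒᵖ
    {y | ∃ a b : Fin (p + q), a < b ∧ y = Ab.of (A.E p q n θ b a)}).restrictScalars ℂ

theorem Jb_mul {j : Ab p q n θ} (hj : j ∈ Jb p q n θ) (y : Ab p q n θ) : j * y ∈ Jb p q n θ :=
  Submodule.smul_mem (Submodule.span (Ab p q n θ)ᵐᵒᵖ _) (MulOpposite.op y) hj

theorem E_mem_Jb {a b : Fin (p + q)} (h : a < b) : Ab.of (A.E p q n θ b a) ∈ Jb p q n θ :=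
  Submodule.subset_span ⟨a, b, h, rfl⟩

theorem Jb_induction {C : Ab p q n θ → Prop}
    (h : ∀ a b : Fin (p + q), a < b → ∀ y, C (Ab.of (A.E p q n θ b a) * y)) (h0 : C 0)
    (hadd : ∀ u v, C u → C v → C (u + v)) {j : Ab p q n θ} (hj : j ∈ Jb p q n θ) : C j := by
  obtain ⟨l, hl⟩ : ∃ l : List (Ab p q n θ), (∀ y ∈ l, ∃ a b : Fin (p + q), a < b ∧
      ∃ z, y = Ab.of (A.E p q n θ b a) * z) ∧ l.sum = j := by
    change j ∈ Submodule.span (Ab p q n θ)ᵐᵒᵖ _ at hj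
    induction hj using Submodule.span_induction with
    | mem y h =>
      obtain ⟨a, b, hab, rfl⟩ := h
      exact ⟨[Ab.of (A.E p q n θ b a)], by simpa using ⟨a, b, hab, 1, by simp⟩, by simp⟩
    | zero => exact ⟨[], by simp, by simp⟩
    | add u v _ _ hu hv =>
      obtain ⟨l, h1, rfl⟩ := hu
      obtain ⟨l', h2, rfl⟩ := hv
      refine ⟨l ++ l', fun y hy => ?_, by simp⟩
      rcases List.mem_append.1 hy with hy | hy
      · exact h1 y hy
      · exact h2 y hy
    | smul r u _ hu =>
      obtain ⟨l, h1, rfl⟩ := hu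
      refine ⟨l.map (fun y => y * r.unop), fun y hy => ?_, ?_⟩
      · obtain ⟨w, hw, rfl⟩ := List.mem_map.1 hy
        obtain ⟨a, b, hab, z, rfl⟩ := h1 w hw
        exact ⟨a, b, hab, z * r.unop, mul_assoc _ _ _⟩
      · rw [List.sum_map_mul_right]; simp
  clear hj
  obtain ⟨h1, rfl⟩ := hl
  induction l with
  | nil => exact h0
  | cons y l ih =>
    rw [List.sum_cons]
    refine hadd _ _ ?_ (ih fun z hz => h1 z (List.mem_cons_of_mem _ hz))
    obtain ⟨a, b, hab, z, rfl⟩ := h1 y List.mem_cons_self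
    exact h a b hab z

theorem poly_mul_Jb (f : MvPolynomial (Fin (p + q)) ℂ) {j : Ab p q n θ} (hj : j ∈ Jb p q n θ) :
    Ab.poly f * j ∈ Jb p q n θ := by
  refine Jb_induction (C := fun j => Ab.poly f * j ∈ Jb p q n θ) ?_ (by simp) ?_ hj
  · intro a b hab y
    rw [← mul_assoc, Ab.weight_mul_poly (A.hasWeight_E b a), mul_assoc]
    exact Jb_mul (E_mem_Jb hab) _
  · intro u v hu hv
    rw [mul_add]; exact add_mem hu hv

theorem inv_mul_Jb {f : MvPolynomial (Fin (p + q)) ℂ} (hf : f ∈ denomPoly (p + q))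
    {j : Ab p q n θ} (hj : j ∈ Jb p q n θ) :
    Ab.inv f * j ∈ Jb p q n θ := by
  refine Jb_induction (C := fun j => Ab.inv f * j ∈ Jb p q n θ) ?_ (by simp) ?_ hj
  · intro a b hab y
    rw [← mul_assoc, Ab.inv_weight (A.hasWeight_E b a) hf, mul_assoc]
    exact Jb_mul (E_mem_Jb hab) _
  · intro u v hu hv
    rw [mul_add]; exact add_mem hu hv

end

section
variable {p q n : ℕ} {θ : ℤˣ}

/-- The index `c`, for `c = 1, …, m - 1` (shifted to start from `0`). -/
def lo {m : ℕ} (c : Fin (m - 1)) : Fin m := ⟨c.val, by omega⟩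
/-- The index `c + 1`. -/
def hi {m : ℕ} (c : Fin (m - 1)) : Fin m := ⟨c.val + 1, by omega⟩

theorem lo_ne_hi {m : ℕ} (c : Fin (m - 1)) : lo c ≠ hi c := by
  intro h; have := congrArg Fin.val h; simp [lo, hi] at this

theorem lo_lt_hi {m : ℕ} (c : Fin (m - 1)) : lo c < hi c := by
  simp [lo, hi, Fin.lt_def]

/-- The simple root `η_c = E_{cc}^* - E_{c+1,c+1}^*`. -/
def root {m : ℕ} (c : Fin (m - 1)) : Fin m → ℤ := Pi.single (lo c) 1 - Pi.single (hi c) 1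

/-- The element `E_c = E_{c,c+1}`. -/
def A.e (c : Fin (p + q - 1)) : A p q n θ := A.E p q n θ (lo c) (hi c)
/-- The element `F_c = E_{c+1,c}`. -/
def A.f (c : Fin (p + q - 1)) : A p q n θ := A.E p q n θ (hi c) (lo c)

/-- The operator `Y ↦ [F_c, Y]`. -/
def A.adF (c : Fin (p + q - 1)) : A p q n θ →ₗ[ℂ] A p q n θ :=
  LinearMap.mulLeft ℂ (A.f c) - LinearMap.mulRight ℂ (A.f c)

/-- The element `H_c - z = E_{cc} - E_{c+1,c+1} - z` of `U(h)`. -/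
def hSub {m : ℕ} (c : Fin (m - 1)) (z : ℤ) : MvPolynomial (Fin m) ℂ :=
  MvPolynomial.X (lo c) - MvPolynomial.X (hi c) - MvPolynomial.C (z : ℂ)

/-- `H_c^{(s)} = H_c (H_c - 1) ⋯ (H_c - s + 1)`, as an element of `U(h)`. -/
def hPow {m : ℕ} (c : Fin (m - 1)) (s : ℕ) : MvPolynomial (Fin m) ℂ :=
  ∏ k ∈ Finset.range s, hSub c k

/-- `ξ_c(Y)`, the series `∑_{s ≥ 0} (s! H_c^{(s)})⁻¹ E_c^s [F_c, [F_c, … [F_c, Y] … ]]`, where `F_c` occurs `s` times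
in the `s`-th term. The term for `s = 0` is `Y`, and only finitely many terms are nonzero. -/
def xiFun (c : Fin (p + q - 1)) (Y : A p q n θ) : Ab p q n θ :=
  ∑ᶠ s : ℕ, Ab.inv ((s.factorial : ℂ) • hPow c s) * Ab.of (A.e c ^ s * (A.adF c ^ s) Y)

theorem hSub_mem {m : ℕ} (c : Fin (m - 1)) (z : ℤ) : hSub c z ∈ denomPoly m :=
  Submonoid.subset_closure ⟨lo c, hi c, lo_ne_hi c, -z, by simp [hSub, sub_eq_add_neg]⟩

theorem hPow_mem {m : ℕ} (c : Fin (m - 1)) (s : ℕ) : hPow c s ∈ denomPoly m :=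
  Submonoid.prod_mem _ fun k _ => hSub_mem c k

theorem adF_apply (c : Fin (p + q - 1)) (Y : A p q n θ) :
    A.adF c Y = A.f c * Y - Y * A.f c := by simp [A.adF]

theorem adF_mul (c : Fin (p + q - 1)) (u v : A p q n θ) :
    A.adF c (u * v) = A.adF c u * v + u * A.adF c v := by
  simp only [adF_apply]; noncomm_ring

theorem pow_le_zero {V : Type} [AddCommGroup V] [Module ℂ V] (D : Module.End ℂ V) {u : V} {i j : ℕ}
    (h : i ≤ j) (hu : (D ^ i) u = 0) : (D ^ j) u = 0 := by
  obtain ⟨k, rfl⟩ := Nat.exists_eq_add_of_le' h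
  rw [pow_add, Module.End.mul_apply, hu, map_zero]

theorem adF_nilp_mul (c : Fin (p + q - 1)) : ∀ (N i j : ℕ) (u v : A p q n θ), i + j = N →
    (A.adF c ^ i) u = 0 → (A.adF c ^ j) v = 0 → (A.adF c ^ N) (u * v) = 0 := by
  intro N
  induction N with
  | zero =>
    intro i j u v h hu hv
    obtain ⟨rfl, rfl⟩ : i = 0 ∧ j = 0 := by omega
    simp at hu; simp [hu]
  | succ N ih =>
    intro i j u v h hu hv
    rw [pow_succ, Module.End.mul_apply, adF_mul, map_add]
    have h1 : (A.adF c ^ N) (A.adF c u * v) = 0 := by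
      rcases i with _ | i
      · simp at hu; simp [hu]
      · exact ih i j _ _ (by omega) (by rwa [pow_succ] at hu) hv
    have h2 : (A.adF c ^ N) (u * A.adF c v) = 0 := by
      rcases j with _ | j
      · simp at hv; simp [hv]
      · exact ih i j _ _ (by omega) hu (by rwa [pow_succ] at hv)
    rw [h1, h2, add_zero]

theorem adF_E (c : Fin (p + q - 1)) (a b : Fin (p + q)) :
    A.adF c (A.E p q n θ a b) =
      (if lo c = a then A.E p q n θ (hi c) b else 0) -
        (if hi c = b then A.E p q n θ a (lo c) else 0) := by
  rw [adF_apply, A.f, A.relations.EE]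

theorem adF_nilp (c : Fin (p + q - 1)) (Y : A p q n θ) : ∃ N, (A.adF c ^ N) Y = 0 := by
  have hlh := lo_ne_hi c
  induction Y using A.induction with
  | hs z => exact ⟨1, by rw [pow_one, adF_apply, Algebra.commutes, sub_self]⟩
  | hE a b =>
    refine ⟨3, ?_⟩
    have : (A.adF c ^ 3) (A.E p q n θ a b) = A.adF c (A.adF c (A.adF c (A.E p q n θ a b))) := rfl
    rw [this]
    by_cases ha : lo c = a
    · subst ha
      by_cases hb : hi c = b
      · subst hb
        simp [adF_E, hlh, hlh.symm]
      · simp [adF_E, hlh, hb]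
    · by_cases hb : hi c = b
      · subst hb
        simp [adF_E, hlh.symm, ha]
      · simp [adF_E, ha, hb]
  | hP a i =>
    refine ⟨2, ?_⟩
    have : (A.adF c ^ 2) (A.P p q n θ a i) = A.adF c (A.adF c (A.P p q n θ a i)) := rfl
    rw [this, adF_apply c (A.P p q n θ a i), A.f, A.pq.Ep]
    split_ifs with h
    · rw [map_neg, adF_apply, A.f, A.pq.Ep, if_neg hlh.symm, neg_zero]
    · simp
  | hQ a i =>
    refine ⟨2, ?_⟩
    have : (A.adF c ^ 2) (A.Q p q n θ a i) = A.adF c (A.adF c (A.Q p q n θ a i)) := rfl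
    rw [this, adF_apply c (A.Q p q n θ a i), A.f, A.pq.Eq]
    split_ifs with h
    · rw [adF_apply, A.f, A.pq.Eq, if_neg hlh]
    · simp
  | hn u hu => obtain ⟨N, hN⟩ := hu; exact ⟨N, by rw [map_neg, hN, neg_zero]⟩
  | hadd u v hu hv =>
    obtain ⟨N, hN⟩ := hu
    obtain ⟨N', hN'⟩ := hv
    exact ⟨max N N', by
      rw [map_add, pow_le_zero _ (le_max_left _ _) hN, pow_le_zero _ (le_max_right _ _) hN',
        add_zero]⟩
  | hmul u v hu hv =>
    obtain ⟨N, hN⟩ := hu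
    obtain ⟨N', hN'⟩ := hv
    exact ⟨N + N', adF_nilp_mul c _ N N' u v rfl hN hN'⟩

/-- The linear operator `W ↦ (s! H_c^{(s)})⁻¹ E_c^s W`. -/
def xiTerm (c : Fin (p + q - 1)) (s : ℕ) : A p q n θ →ₗ[ℂ] Ab p q n θ :=
  LinearMap.mulLeft ℂ (Ab.inv ((s.factorial : ℂ) • hPow c s)) ∘ₗ Ab.of.toLinearMap ∘ₗ
    LinearMap.mulLeft ℂ (A.e c ^ s)

theorem xiTerm_apply (c : Fin (p + q - 1)) (s : ℕ) (W : A p q n θ) :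
    xiTerm c s W = Ab.inv ((s.factorial : ℂ) • hPow c s) * Ab.of (A.e c ^ s * W) := rfl

theorem xiFun_eq_sum (c : Fin (p + q - 1)) (Y : A p q n θ) {N : ℕ} (h : (A.adF c ^ N) Y = 0) :
    xiFun c Y = ∑ s ∈ Finset.range N, xiTerm c s ((A.adF c ^ s) Y) := by
  refine finsum_eq_sum_of_support_subset _ fun s hs => ?_
  by_contra hN
  apply hs
  have : N ≤ s := by simpa using hN
  change xiTerm c s ((A.adF c ^ s) Y) = 0
  rw [pow_le_zero _ this h, map_zero]

/-- The linear map `ξ_c : A → Ab`. -/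
def xi (c : Fin (p + q - 1)) : A p q n θ →ₗ[ℂ] Ab p q n θ where
  toFun := xiFun c
  map_add' u v := by
    obtain ⟨N, hN⟩ := adF_nilp c u
    obtain ⟨N', hN'⟩ := adF_nilp c v
    have h1 := pow_le_zero _ (le_max_left N N') hN
    have h2 := pow_le_zero _ (le_max_right N N') hN'
    rw [xiFun_eq_sum c u h1, xiFun_eq_sum c v h2,
      xiFun_eq_sum c (u + v) (by rw [map_add, h1, h2, add_zero]), ← Finset.sum_add_distrib]
    simp only [map_add]
  map_smul' z u := by
    obtain ⟨N, hN⟩ := adF_nilp c u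
    rw [xiFun_eq_sum c u hN, xiFun_eq_sum c (z • u) (by rw [map_smul, hN, smul_zero]),
      RingHom.id_apply, Finset.smul_sum]
    simp only [map_smul]

theorem xi_eq_sum (c : Fin (p + q - 1)) (Y : A p q n θ) {N : ℕ} (h : (A.adF c ^ N) Y = 0) :
    xi c Y = ∑ s ∈ Finset.range N, xiTerm c s ((A.adF c ^ s) Y) := xiFun_eq_sum c Y h

theorem factorial_hPow_mem_isUnit (c : Fin (p + q - 1)) (s : ℕ) :
    Ab.inv ((s.factorial : ℂ) • hPow c s) =
      ((s.factorial : ℂ)⁻¹) • (Ab.inv (hPow c s) : Ab p q n θ) := by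
  have hs : (s.factorial : ℂ) ≠ 0 := by exact_mod_cast s.factorial_ne_zero
  have h1 := Ab.inv_mul (n := n) (θ := θ) (hPow_mem c s)
  have h2 := Ab.mul_inv (n := n) (θ := θ) (hPow_mem c s)
  have h3 : (Ab.poly ((s.factorial : ℂ) • hPow c s) : Ab p q n θ) *
      (((s.factorial : ℂ)⁻¹) • Ab.inv (hPow c s)) = 1 := by
    rw [map_smul, smul_mul_smul_comm, h2, mul_inv_cancel₀ hs, one_smul]
  have h4 : (((s.factorial : ℂ)⁻¹) • Ab.inv (hPow c s)) *
      (Ab.poly ((s.factorial : ℂ) • hPow c s) : Ab p q n θ) = 1 := by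
    rw [map_smul, smul_mul_smul_comm, h1, inv_mul_cancel₀ hs, one_smul]
  exact Ring.inverse_unit ⟨_, _, h3, h4⟩

theorem hPow_succ {m : ℕ} (c : Fin (m - 1)) (s : ℕ) : hPow c (s + 1) = hPow c s * hSub c s :=
  Finset.prod_range_succ _ _

theorem xiTerm_eq (c : Fin (p + q - 1)) (s : ℕ) (W : A p q n θ) :
    xiTerm c s W = ((s.factorial : ℂ)⁻¹) • (Ab.inv (hPow c s) * Ab.of (A.e c ^ s * W)) := by
  rw [xiTerm_apply, factorial_hPow_mem_isUnit, smul_mul_assoc]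

/-- `(s + 1) (H_c - s) ((s + 1)! H_c^{(s + 1)})⁻¹ = (s! H_c^{(s)})⁻¹`. -/
theorem xi_coeff (c : Fin (p + q - 1)) (s : ℕ) (w : Ab p q n θ) :
    ((s : ℂ) + 1) • ((((s + 1).factorial : ℂ)⁻¹) •
      (Ab.inv (hPow c (s + 1)) * (Ab.poly (hSub c s) * w))) =
      ((s.factorial : ℂ)⁻¹) • (Ab.inv (hPow c s) * w) := by
  have h0 : (s : ℂ) + 1 ≠ 0 := by exact_mod_cast s.succ_ne_zero
  rw [smul_smul, hPow_succ, Ab.inv_mul_inv (hPow_mem c s) (hSub_mem c s), Nat.factorial_succ,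
    mul_assoc, ← mul_assoc _ _ w, Ab.inv_mul (hSub_mem c s), one_mul]
  congr 1
  push_cast
  rw [mul_inv, ← mul_assoc, mul_inv_cancel₀ h0, one_mul]

theorem e_weight (c : Fin (p + q - 1)) : A.HasWeight (root c) (A.e c : A p q n θ) :=
  A.hasWeight_E _ _

theorem e_pow_weight (c : Fin (p + q - 1)) (s : ℕ) :
    A.HasWeight ((s : ℤ) • root c) (A.e c ^ s : A p q n θ) := by
  induction s with
  | zero => intro a; simp
  | succ s ih =>
    rw [pow_succ]
    convert ih.mul (e_weight c) using 1
    push_cast; rw [add_smul, one_smul]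

theorem xiTerm_poly (c : Fin (p + q - 1)) (s : ℕ) (f : MvPolynomial (Fin (p + q)) ℂ)
    (W : A p q n θ) :
    xiTerm c s (A.ofPoly f * W) = Ab.poly (shift (-((s : ℤ) • root c)) f) * xiTerm c s W := by
  rw [xiTerm_eq, xiTerm_eq, ← mul_assoc, (e_pow_weight c s).mul_poly, mul_assoc, map_mul,
    ← Ab.poly_apply, ← mul_assoc, Ab.inv_comm_poly (hPow_mem c s), mul_smul_comm, mul_assoc]

theorem ofPoly_hSub (c : Fin (p + q - 1)) (z : ℤ) : (A.ofPoly (hSub c z) : A p q n θ) =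
    A.E p q n θ (lo c) (lo c) - A.E p q n θ (hi c) (hi c) - algebraMap ℂ _ (z : ℂ) := by
  have : (MvPolynomial.C (z : ℂ) : MvPolynomial (Fin (p + q)) ℂ) = algebraMap ℂ _ (z : ℂ) := rfl
  rw [hSub, map_sub, map_sub, A.ofPoly_X, A.ofPoly_X, this, AlgHom.commutes]

theorem e_mul_f (c : Fin (p + q - 1)) :
    (A.e c * A.f c : A p q n θ) = A.f c * A.e c + A.ofPoly (hSub c 0) := by
  have := A.relations.EE (E := A.E p q n θ) (lo c) (hi c) (hi c) (lo c)
  rw [if_pos rfl, if_pos rfl] at this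
  rw [ofPoly_hSub, A.e, A.f, sub_eq_iff_eq_add'.1 this]
  simp

theorem e_pow_f (c : Fin (p + q - 1)) (s : ℕ) :
    (A.e c ^ (s + 1) * A.f c : A p q n θ) =
      A.f c * A.e c ^ (s + 1) + ((s : ℂ) + 1) • (A.ofPoly (hSub c s) * A.e c ^ s) := by
  induction s with
  | zero => simp [e_mul_f]
  | succ s ih =>
    have hw := (e_weight (n := n) (θ := θ) c).mul_poly (hSub c s)
    have hs : shift (-root c) (hSub c s) = hSub c s - algebraMap ℂ _ 2 := by
      have : ∀ z, (algebraMap ℂ (MvPolynomial (Fin (p + q)) ℂ) z) = MvPolynomial.C z :=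
        fun z => rfl
      simp [hSub, shift, root, (lo_ne_hi c).symm, lo_ne_hi c]
      rw [← MvPolynomial.C_1, ← one_add_one_eq_two, map_add]; ring
    rw [pow_succ', mul_assoc, ih, mul_add, ← mul_assoc, e_mul_f, mul_smul_comm,
      ← mul_assoc _ _ (A.e c ^ s), hw, hs, mul_assoc _ _ (A.e c ^ s), ← pow_succ', add_mul,
      mul_assoc, ← pow_succ', add_assoc]
    congr 1
    simp only [ofPoly_hSub, map_sub, AlgHom.commutes, sub_mul, smul_sub, ← Algebra.smul_def]
    push_cast
    module

/-- Reduction modulo `Jb`. -/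
theorem xiTerm_f (c : Fin (p + q - 1)) (s : ℕ) (W : A p q n θ) :
    xiTerm c (s + 1) (A.f c * W) - xiTerm c s W ∈ Jb p q n θ := by
  have h1 : xiTerm c (s + 1) (A.f c * W) = (((s + 1).factorial : ℂ)⁻¹) •
      (Ab.inv (hPow c (s + 1)) * (Ab.of (A.f c) * Ab.of (A.e c ^ (s + 1) * W))) +
        xiTerm c s W := by
    rw [xiTerm_eq, xiTerm_eq, ← xi_coeff c s, ← mul_assoc, e_pow_f, add_mul, map_add, mul_add,
      smul_add, mul_assoc (A.f c), map_mul _ (A.f c), smul_mul_assoc, map_smul, mul_smul_comm,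
      mul_assoc, map_mul _ (A.ofPoly _), ← Ab.poly_apply]
    rw [smul_comm]
  rw [h1, add_sub_cancel_right]
  exact Submodule.smul_mem _ _ (inv_mul_Jb (hPow_mem _ _) (Jb_mul (E_mem_Jb (lo_lt_hi c)) _))

theorem xiTerm_e (c : Fin (p + q - 1)) (s : ℕ) (W : A p q n θ) :
    xiTerm c s (A.e c * W) = ((s : ℂ) + 1) • (Ab.poly (hSub c s) * xiTerm c (s + 1) W) := by
  rw [xiTerm_eq, xiTerm_eq, ← xi_coeff c s, ← mul_assoc (A.e c ^ s) (A.e c) W, ← pow_succ,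
    mul_smul_comm, ← mul_assoc (Ab.inv _), ← mul_assoc (Ab.poly _),
    Ab.inv_comm_poly (hPow_mem _ _)]

end

section
variable {p q n : ℕ} {θ : ℤˣ}

theorem poly_X_add (a : Fin (p + q)) (η : Fin (p + q) → ℤ) :
    (Ab.poly (shift η (MvPolynomial.X a)) : Ab p q n θ) =
      Ab.poly (MvPolynomial.X a) + algebraMap ℂ _ (η a : ℂ) := by
  have : (MvPolynomial.C (η a : ℂ) : MvPolynomial (Fin (p + q)) ℂ) = algebraMap ℂ _ (η a : ℂ) := rfl
  rw [shift, MvPolynomial.aeval_X, map_add, this, AlgHom.commutes]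

theorem adF_cartan (c : Fin (p + q - 1)) (a : Fin (p + q)) :
    A.adF c (A.E p q n θ a a) = (root c a : ℂ) • A.f c := by
  have h := A.hasWeight_E (n := n) (θ := θ) (hi c) (lo c) a
  rw [adF_apply, A.f, ← neg_sub, h, ← neg_smul]
  simp [root]

theorem adF_f (c : Fin (p + q - 1)) (Y : A p q n θ) :
    A.adF c (A.f c * Y) = A.f c * A.adF c Y := by
  rw [adF_mul, adF_apply c (A.f c), sub_self, zero_mul, zero_add]

theorem adF_pow_cartan (c : Fin (p + q - 1)) (a : Fin (p + q)) (Y : A p q n θ) (s : ℕ) :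
    (A.adF c ^ (s + 1)) (A.E p q n θ a a * Y) = A.E p q n θ a a * (A.adF c ^ (s + 1)) Y +
      (((s : ℂ) + 1) * (root c a : ℂ)) • (A.f c * (A.adF c ^ s) Y) := by
  induction s with
  | zero => simp [adF_mul, adF_cartan, add_comm]
  | succ s ih =>
    rw [pow_succ', Module.End.mul_apply, ih, map_add, adF_mul, adF_cartan, map_smul, adF_f,
      ← Module.End.mul_apply, ← Module.End.mul_apply, ← pow_succ', ← pow_succ', smul_mul_assoc]
    push_cast
    module

theorem xi_X (c : Fin (p + q - 1)) (a : Fin (p + q)) (Y : A p q n θ) :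
    xi c (A.E p q n θ a a * Y) - Ab.poly (shift (root c) (MvPolynomial.X a)) * xi c Y ∈
      Jb p q n θ := by
  obtain ⟨N, hN⟩ := adF_nilp c Y
  have h1 : (A.adF c ^ (N + 1)) (A.E p q n θ a a * Y) = 0 := by
    rw [adF_pow_cartan, hN, pow_le_zero _ (Nat.le_succ N) hN]; simp
  rw [xi_eq_sum c _ h1, xi_eq_sum c Y hN, Finset.sum_range_succ']
  simp only [adF_pow_cartan, map_add, Finset.sum_add_distrib, pow_zero, Module.End.one_apply]
  have h2 : ∑ s ∈ Finset.range N, xiTerm c (s + 1) (A.E p q n θ a a * (A.adF c ^ (s + 1)) Y) +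
      xiTerm c 0 (A.E p q n θ a a * Y) =
      ∑ s ∈ Finset.range N, xiTerm c s (A.E p q n θ a a * (A.adF c ^ s) Y) := by
    have := Finset.sum_range_succ'
      (fun s => xiTerm c s (A.E p q n θ a a * (A.adF c ^ s) Y)) N
    rw [Finset.sum_range_succ, hN, mul_zero, map_zero, add_zero] at this
    rw [this]; simp
  rw [add_right_comm, h2, Finset.mul_sum, ← Finset.sum_add_distrib, ← Finset.sum_sub_distrib]
  refine Submodule.sum_mem _ fun s _ => ?_
  have h3 := Submodule.smul_mem _ (((s : ℂ) + 1) * (root c a : ℂ))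
    (xiTerm_f c s ((A.adF c ^ s) Y))
  convert h3 using 1
  rw [← A.ofPoly_X, xiTerm_poly, poly_X_add, poly_X_add, add_mul (Ab.poly _), add_mul (Ab.poly _), ← Algebra.smul_def,
    ← Algebra.smul_def, map_smul]
  simp
  module

/-- `ξ_c(X Y) ∈ Z ξ_c(Y) + Jb` for `X ∈ U(h)`, where `Z(μ) = X(μ + η_c)`. -/
theorem xi_poly (c : Fin (p + q - 1)) (f : MvPolynomial (Fin (p + q)) ℂ) (Y : A p q n θ) :
    xi c (A.ofPoly f * Y) - Ab.poly (shift (root c) f) * xi c Y ∈ Jb p q n θ := by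
  induction f using MvPolynomial.induction_on generalizing Y with
  | C z =>
    have : (MvPolynomial.C z : MvPolynomial (Fin (p + q)) ℂ) = algebraMap ℂ _ z := rfl
    rw [this, AlgHom.commutes, AlgHom.commutes, AlgHom.commutes, ← Algebra.smul_def,
      ← Algebra.smul_def, map_smul, sub_self]
    exact zero_mem _
  | add f g hf hg =>
    convert add_mem (hf Y) (hg Y) using 1
    simp only [map_add, add_mul]; abel
  | mul_X f a hf =>
    have h1 := hf (A.E p q n θ a a * Y)
    have h2 := poly_mul_Jb (shift (root c) f) (xi_X c a Y)
    convert add_mem h1 h2 using 1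
    rw [map_mul A.ofPoly, map_mul (shift _), map_mul Ab.poly, A.ofPoly_X, mul_assoc, mul_sub,
      mul_assoc]
    abel

theorem adF_e (c : Fin (p + q - 1)) :
    A.adF c (A.e c) = - (A.ofPoly (hSub c 0) : A p q n θ) := by
  rw [adF_apply, e_mul_f]; abel

theorem adF_h (c : Fin (p + q - 1)) :
    A.adF c (A.ofPoly (hSub c 0)) = (2 : ℂ) • (A.f c : A p q n θ) := by
  rw [ofPoly_hSub, map_sub, map_sub, adF_cartan, adF_cartan, adF_apply c (algebraMap _ _ _),
    Algebra.commutes, sub_self, sub_zero, ← sub_smul]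
  congr 1
  simp [root, lo_ne_hi c, (lo_ne_hi c).symm]
  norm_num

theorem adF_pow_e_one (c : Fin (p + q - 1)) (Y : A p q n θ) :
    A.adF c (A.e c * Y) = A.e c * A.adF c Y - A.ofPoly (hSub c 0) * Y := by
  rw [adF_mul, adF_e]; noncomm_ring

theorem adF_pow_e (c : Fin (p + q - 1)) (Y : A p q n θ) (s : ℕ) :
    (A.adF c ^ (s + 2)) (A.e c * Y) = A.e c * (A.adF c ^ (s + 2)) Y -
      ((s : ℂ) + 2) • (A.ofPoly (hSub c 0) * (A.adF c ^ (s + 1)) Y) -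
      (((s : ℂ) + 2) * ((s : ℂ) + 1)) • (A.f c * (A.adF c ^ s) Y) := by
  induction s with
  | zero =>
    rw [zero_add, pow_succ', Module.End.mul_apply, pow_one, adF_pow_e_one, map_sub, adF_pow_e_one,
      adF_mul, adF_h]
    simp only [pow_zero, Module.End.one_apply, smul_mul_assoc, Module.End.mul_apply]
    push_cast
    module
  | succ s ih =>
    rw [show s + 1 + 2 = (s + 2) + 1 from rfl, pow_succ', Module.End.mul_apply, ih, map_sub,
      map_sub, adF_pow_e_one, map_smul, adF_mul, adF_h, map_smul, adF_f,
      ← Module.End.mul_apply, ← pow_succ', ← Module.End.mul_apply, ← pow_succ',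
      ← Module.End.mul_apply, ← pow_succ', smul_mul_assoc]
    push_cast
    module

theorem xi_e (c : Fin (p + q - 1)) (Y : A p q n θ) : xi c (A.e c * Y) ∈ Jb p q n θ := by
  obtain ⟨N, hN⟩ := adF_nilp c Y
  have hN1 := pow_le_zero _ (Nat.le_add_right N 1) hN
  have hN2 := pow_le_zero _ (Nat.le_add_right N 2) hN
  have h1 : (A.adF c ^ (N + 2)) (A.e c * Y) = 0 := by
    rw [adF_pow_e, hN, hN1, hN2]; simp
  rw [xi_eq_sum c _ h1, Finset.sum_range_succ', Finset.sum_range_succ']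
  simp only [adF_pow_e, map_sub, Finset.sum_sub_distrib, pow_zero, Module.End.one_apply,
    zero_add, pow_one, adF_pow_e_one]
  have h2 : ∑ s ∈ Finset.range N, xiTerm c (s + 2) (A.e c * (A.adF c ^ (s + 2)) Y) +
      xiTerm c 1 (A.e c * A.adF c Y) + xiTerm c 0 (A.e c * Y) =
      ∑ s ∈ Finset.range N, xiTerm c s (A.e c * (A.adF c ^ s) Y) := by
    have := Finset.sum_range_succ'
      (fun s => xiTerm c s (A.e c * (A.adF c ^ s) Y)) (N + 1)
    rw [Finset.sum_range_succ, hN1, mul_zero, map_zero, add_zero, Finset.sum_range_succ, hN,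
      mul_zero, map_zero, add_zero, Finset.sum_range_succ'] at this
    rw [this]; simp
  have h3 : ∑ s ∈ Finset.range N, xiTerm c (s + 2)
        (((s : ℂ) + 2) • (A.ofPoly (hSub c 0) * (A.adF c ^ (s + 1)) Y)) +
      xiTerm c 1 (A.ofPoly (hSub c 0) * Y) =
      ∑ s ∈ Finset.range N, xiTerm c (s + 1)
        (((s : ℂ) + 1) • (A.ofPoly (hSub c 0) * (A.adF c ^ s) Y)) := by
    have := Finset.sum_range_succ' (fun s : ℕ => xiTerm c (s + 1)
        (((s : ℂ) + 1) • (A.ofPoly (hSub c 0) * (A.adF c ^ s) Y))) N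
    rw [Finset.sum_range_succ, hN, mul_zero, smul_zero, map_zero, add_zero] at this
    have e : ∀ s : ℕ, ((s + 1 : ℕ) : ℂ) + 1 = s + 2 := by intro s; push_cast; ring
    simp only [e, Nat.cast_zero, zero_add, one_smul, pow_zero, Module.End.one_apply] at this
    rw [this]
  have h4 : ∀ x1 x2 x3 y1 y2 z : Ab p q n θ,
      x1 - x2 - x3 + (y1 - y2) + z = (x1 + y1 + z) - (x2 + y2) - x3 := by intros; abel
  rw [h4, h2, h3, ← Finset.sum_sub_distrib, ← Finset.sum_sub_distrib]
  refine Submodule.sum_mem _ fun s _ => ?_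
  have h5 := Submodule.smul_mem _ (-(((s : ℂ) + 2) * ((s : ℂ) + 1)))
    (xiTerm_f c (s + 1) ((A.adF c ^ s) Y))
  convert h5 using 1
  have h6 : (Ab.poly (hSub c s) : Ab p q n θ) =
      Ab.poly (hSub c 0) - algebraMap ℂ _ (s : ℂ) := by
    rw [Ab.poly_apply, Ab.poly_apply, ofPoly_hSub, ofPoly_hSub, ← AlgHom.commutes Ab.of, ← map_sub]
    simp
  have h7 : (Ab.poly (shift (-(((s + 1 : ℕ) : ℤ) • root c)) (hSub c 0)) : Ab p q n θ) =
      Ab.poly (hSub c 0) - algebraMap ℂ _ (2 * ((s : ℂ) + 1)) := by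
    have : shift (-(((s + 1 : ℕ) : ℤ) • root c)) (hSub c 0) =
        hSub c 0 - algebraMap ℂ _ (2 * ((s : ℂ) + 1)) := by
      have : ∀ z, (algebraMap ℂ (MvPolynomial (Fin (p + q)) ℂ) z) = MvPolynomial.C z :=
        fun z => rfl
      simp [hSub, shift, root, (lo_ne_hi c).symm, lo_ne_hi c]
      rw [show (MvPolynomial.C 2 : MvPolynomial (Fin (p + q)) ℂ) = 2 from map_ofNat _ 2]; ring
    rw [this, map_sub, AlgHom.commutes]
  rw [xiTerm_e, map_smul, xiTerm_poly, map_smul, h6, h7, sub_mul, sub_mul, ← Algebra.smul_def,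
    ← Algebra.smul_def]
  module

/-- The span of `E_{ba} A` for `a < b`, `(b, a) ≠ (c + 1, c)`. -/
def nc (c : Fin (p + q - 1)) : Submodule ℂ (A p q n θ) :=
  Submodule.span ℂ {u | ∃ a b : Fin (p + q), a < b ∧ ¬ (a = lo c ∧ b = hi c) ∧
    ∃ Y, u = A.E p q n θ b a * Y}

theorem E_mem_nc (c : Fin (p + q - 1)) {a b : Fin (p + q)} (h : a < b)
    (h' : ¬ (a = lo c ∧ b = hi c)) (Y : A p q n θ) : A.E p q n θ b a * Y ∈ nc c :=
  Submodule.subset_span ⟨a, b, h, h', Y, rfl⟩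

theorem adF_nc (c : Fin (p + q - 1)) {u : A p q n θ} (hu : u ∈ nc c) : A.adF c u ∈ nc c := by
  induction hu using Submodule.span_induction with
  | mem u hu =>
    obtain ⟨a, b, hab, hc, Y, rfl⟩ := hu
    rw [adF_mul, adF_E]
    refine add_mem ?_ (E_mem_nc c hab hc _)
    simp only [lo, hi, Fin.ext_iff, Fin.lt_def] at *
    rw [sub_mul]
    refine sub_mem ?_ ?_
    · split_ifs with h
      · exact E_mem_nc c (by simp only [Fin.lt_def]; omega) (by simp only [lo, hi, Fin.ext_iff]; omega) _
      · simp
    · split_ifs with h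
      · exact E_mem_nc c (by simp only [Fin.lt_def]; omega) (by simp only [lo, hi, Fin.ext_iff]; omega) _
      · simp
  | zero => simp
  | add u v _ _ hu hv => rw [map_add]; exact add_mem hu hv
  | smul z u _ hu => rw [map_smul]; exact Submodule.smul_mem _ _ hu

theorem e_mul_nc (c : Fin (p + q - 1)) {u : A p q n θ} (hu : u ∈ nc c) : A.e c * u ∈ nc c := by
  induction hu using Submodule.span_induction with
  | mem u hu =>
    obtain ⟨a, b, hab, hc, Y, rfl⟩ := hu
    have := A.relations.EE (E := A.E p q n θ) (lo c) (hi c) b a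
    rw [← mul_assoc, A.e, sub_eq_iff_eq_add'.1 this, add_mul, mul_assoc]
    refine add_mem (E_mem_nc c hab hc _) ?_
    simp only [lo, hi, Fin.ext_iff, Fin.lt_def] at *
    rw [sub_mul]
    refine sub_mem ?_ ?_
    · split_ifs with h
      · exact E_mem_nc c (by simp only [Fin.lt_def]; omega) (by simp only [lo, hi, Fin.ext_iff]; omega) _
      · simp
    · split_ifs with h
      · exact E_mem_nc c (by simp only [Fin.lt_def]; omega) (by simp only [lo, hi, Fin.ext_iff]; omega) _
      · simp
  | zero => simp
  | add u v _ _ hu hv => rw [mul_add]; exact add_mem hu hv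
  | smul z u _ hu => rw [mul_smul_comm]; exact Submodule.smul_mem _ _ hu

theorem nc_le (c : Fin (p + q - 1)) {u : A p q n θ} (hu : u ∈ nc c) : Ab.of u ∈ Jb p q n θ := by
  induction hu using Submodule.span_induction with
  | mem u hu =>
    obtain ⟨a, b, hab, hc, Y, rfl⟩ := hu
    rw [map_mul]; exact Jb_mul (E_mem_Jb hab) _
  | zero => simp
  | add u v _ _ hu hv => rw [map_add]; exact add_mem hu hv
  | smul z u _ hu => rw [map_smul]; exact Submodule.smul_mem _ _ hu

theorem xi_nc (c : Fin (p + q - 1)) {u : A p q n θ} (hu : u ∈ nc c) : xi c u ∈ Jb p q n θ := by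
  obtain ⟨N, hN⟩ := adF_nilp c u
  rw [xi_eq_sum c u hN]
  refine Submodule.sum_mem _ fun s _ => ?_
  rw [xiTerm_eq]
  refine Submodule.smul_mem _ _ (inv_mul_Jb (hPow_mem c s) (nc_le c ?_))
  have h1 : ∀ s, (A.adF c ^ s) u ∈ nc c := by
    intro s
    induction s with
    | zero => simpa using hu
    | succ s ih => rw [pow_succ', Module.End.mul_apply]; exact adF_nc c ih
  have h2 : ∀ s, ∀ v ∈ nc c, (A.e c ^ s * v : A p q n θ) ∈ nc c := by
    intro s
    induction s with
    | zero => intro v hv; simpa using hv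
    | succ s ih => intro v hv; rw [pow_succ, mul_assoc]; exact ih _ (e_mul_nc c hv)
  exact h2 s _ (h1 s)

/-- `ξ_c` vanishes modulo `Jb` on the elements of `σ_c(n) A`. -/
theorem xi_swap (c : Fin (p + q - 1)) {a b : Fin (p + q)} (hab : a < b) (Y : A p q n θ) :
    xi c (A.E p q n θ (Equiv.swap (lo c) (hi c) b) (Equiv.swap (lo c) (hi c) a) * Y) ∈
      Jb p q n θ := by
  by_cases h : a = lo c ∧ b = hi c
  · obtain ⟨rfl, rfl⟩ := h
    rw [Equiv.swap_apply_left, Equiv.swap_apply_right]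
    exact xi_e c Y
  · refine xi_nc c (E_mem_nc c ?_ ?_ Y)
    · rw [Equiv.swap_apply_def, Equiv.swap_apply_def]
      simp only [lo, hi, Fin.ext_iff, Fin.lt_def] at *
      split_ifs <;> (try dsimp only) <;> omega
    · rw [Equiv.swap_apply_def, Equiv.swap_apply_def]
      simp only [lo, hi, Fin.ext_iff, Fin.lt_def] at *
      split_ifs <;> (try dsimp only) <;> omega

theorem xi_rep_eq (c : Fin (p + q - 1)) {f g : MvPolynomial (Fin (p + q)) ℂ}
    (hf : f ∈ denomPoly (p + q)) (hg : g ∈ denomPoly (p + q)) {Y Z : A p q n θ}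
    (h : Ab.inv f * Ab.of Y = Ab.inv g * Ab.of Z) :
    Ab.inv (shift (root c) f) * xi c Y - Ab.inv (shift (root c) g) * xi c Z ∈ Jb p q n θ := by
  have hτf := shift_mem (root c) hf
  have hτg := shift_mem (root c) hg
  have h1 : Ab.of (A.ofPoly g * Y) = Ab.of (A.ofPoly f * Z) := by
    rw [map_mul, map_mul, ← Ab.poly_apply, ← Ab.poly_apply]
    calc Ab.poly g * Ab.of Y = Ab.poly g * (Ab.poly f * Ab.inv f) * Ab.of Y := by
          rw [Ab.mul_inv hf, mul_one]
      _ = Ab.poly (g * f) * (Ab.inv f * Ab.of Y) := by rw [map_mul]; noncomm_ring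
      _ = Ab.poly f * (Ab.poly g * Ab.inv g) * Ab.of Z := by
          rw [h, mul_comm g f, map_mul]; noncomm_ring
      _ = _ := by rw [Ab.mul_inv hg, mul_one]
  obtain ⟨k, hk, h2⟩ := Ab.of_eq h1
  have hτk := shift_mem (root c) hk
  rw [← mul_assoc, ← mul_assoc, ← map_mul, ← map_mul] at h2
  have h3 := xi_poly c (k * g) Y
  have h4 := xi_poly c (k * f) Z
  rw [h2] at h3
  have h5 := sub_mem h4 h3
  rw [sub_sub_sub_cancel_left] at h5
  have h6 := inv_mul_Jb (mul_mem hτk (mul_mem hτf hτg)) h5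
  set τ := shift (root c) with hτ
  convert h6 using 1
  rw [Ab.inv_mul_inv hτk (mul_mem hτf hτg), Ab.inv_mul_inv hτf hτg, mul_sub]
  have e1 : ∀ w : Ab p q n θ, Ab.inv (τ k) * (Ab.inv (τ f) * Ab.inv (τ g)) *
      (Ab.poly (τ (k * g)) * w) = Ab.inv (τ f) * w := by
    intro w
    calc Ab.inv (τ k) * (Ab.inv (τ f) * Ab.inv (τ g)) * (Ab.poly (τ (k * g)) * w)
        = Ab.inv (τ k) * (Ab.inv (τ f) * (Ab.inv (τ g) * Ab.poly (τ g)) * Ab.poly (τ k)) * w := by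
          rw [mul_comm k g, map_mul, map_mul]; noncomm_ring
      _ = Ab.inv (τ k) * Ab.poly (τ k) * Ab.inv (τ f) * w := by
          rw [Ab.inv_mul hτg, mul_one, Ab.inv_comm_poly hτf]; noncomm_ring
      _ = _ := by rw [Ab.inv_mul hτk, one_mul]
  have e2 : ∀ w : Ab p q n θ, Ab.inv (τ k) * (Ab.inv (τ f) * Ab.inv (τ g)) *
      (Ab.poly (τ (k * f)) * w) = Ab.inv (τ g) * w := by
    intro w
    calc Ab.inv (τ k) * (Ab.inv (τ f) * Ab.inv (τ g)) * (Ab.poly (τ (k * f)) * w)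
        = Ab.inv (τ k) * (Ab.inv (τ f) * (Ab.inv (τ g) * Ab.poly (τ f)) * Ab.poly (τ k)) * w := by
          rw [mul_comm k f, map_mul, map_mul]; noncomm_ring
      _ = Ab.inv (τ k) * ((Ab.inv (τ f) * Ab.poly (τ f)) * (Ab.inv (τ g) * Ab.poly (τ k))) * w := by
          rw [Ab.inv_comm_poly hτg]; noncomm_ring
      _ = Ab.inv (τ k) * Ab.poly (τ k) * Ab.inv (τ g) * w := by
          rw [Ab.inv_mul hτf, one_mul, Ab.inv_comm_poly hτg, ← mul_assoc]
      _ = _ := by rw [Ab.inv_mul hτk, one_mul]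
  rw [e1, e2]

/-- There is exactly one linear map `Ab → Jb \ Ab` that takes `X Y` to `Z ξ_c(Y) + Jb`, for every
`X = g⁻¹ f` in the ring of fractions of `U(h)` and every `Y` in `A`, where `Z(μ) = X(μ + η_c)`. -/
theorem existsUnique_xiBar (c : Fin (p + q - 1)) :
    ∃! T : Ab p q n θ →ₗ[ℂ] Ab p q n θ ⧸ Jb p q n θ,
      ∀ f g : MvPolynomial (Fin (p + q)) ℂ, g ∈ denomPoly (p + q) → ∀ Y : A p q n θ,
        T (Ab.inv g * Ab.poly f * Ab.of Y) = (Jb p q n θ).mkQ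
          (Ab.inv (shift (root c) g) * Ab.poly (shift (root c) f) * xi c Y) := by
  choose d hd N hN using Ab.exists_rep (p := p) (q := q) (n := n) (θ := θ)
  have key : ∀ g ∈ denomPoly (p + q), ∀ Y : A p q n θ,
      (Jb p q n θ).mkQ (Ab.inv (shift (root c) (d (Ab.inv g * Ab.of Y))) *
        xi c (N (Ab.inv g * Ab.of Y))) =
      (Jb p q n θ).mkQ (Ab.inv (shift (root c) g) * xi c Y) := by
    intro g hg Y
    rw [← sub_eq_zero, ← map_sub, Submodule.mkQ_apply, Submodule.Quotient.mk_eq_zero]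
    exact xi_rep_eq c (hd _) hg (hN _).symm
  let T : Ab p q n θ →ₗ[ℂ] Ab p q n θ ⧸ Jb p q n θ :=
    { toFun := fun y => (Jb p q n θ).mkQ (Ab.inv (shift (root c) (d y)) * xi c (N y))
      map_add' := by
        intro u v
        have hu := hd u
        have hv := hd v
        have e : u + v = Ab.inv (d u * d v) *
            Ab.of (A.ofPoly (d v) * N u + A.ofPoly (d u) * N v) := by
          nth_rewrite 1 [hN u, hN v]
          rw [map_add, map_mul, map_mul, ← Ab.poly_apply, ← Ab.poly_apply, mul_add,
            Ab.inv_mul_inv hu hv, mul_assoc, ← mul_assoc (Ab.inv (d v)) (Ab.poly (d v)),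
            Ab.inv_mul hv, one_mul]
          congr 1
          rw [mul_assoc, ← mul_assoc (Ab.inv (d v)) (Ab.poly (d u)), Ab.inv_comm_poly hv,
            mul_assoc, ← mul_assoc, ← mul_assoc, Ab.inv_mul hu, one_mul]
        have hu' := shift_mem (root c) hu
        have hv' := shift_mem (root c) hv
        have h1 := key _ (mul_mem hu hv) (A.ofPoly (d v) * N u + A.ofPoly (d u) * N v)
        rw [← e] at h1
        rw [h1, ← map_add, ← sub_eq_zero, ← map_sub, Submodule.mkQ_apply,
          Submodule.Quotient.mk_eq_zero]
        have h2 := inv_mul_Jb (mul_mem hu' hv')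
          (add_mem (xi_poly c (d v) (N u)) (xi_poly c (d u) (N v)))
        convert h2 using 1
        rw [map_mul, map_add, mul_add, mul_add, mul_sub, mul_sub]
        have e1 : ∀ w : Ab p q n θ, Ab.inv (shift (root c) (d u) * shift (root c) (d v)) *
            (Ab.poly (shift (root c) (d v)) * w) = Ab.inv (shift (root c) (d u)) * w := by
          intro w
          rw [Ab.inv_mul_inv hu' hv', mul_assoc, ← mul_assoc _ _ w, Ab.inv_mul hv', one_mul]
        have e2 : ∀ w : Ab p q n θ, Ab.inv (shift (root c) (d u) * shift (root c) (d v)) *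
            (Ab.poly (shift (root c) (d u)) * w) = Ab.inv (shift (root c) (d v)) * w := by
          intro w
          rw [mul_comm (shift (root c) (d u)), Ab.inv_mul_inv hv' hu', mul_assoc,
            ← mul_assoc _ _ w, Ab.inv_mul hu', one_mul]
        rw [e1, e2]; abel
      map_smul' := by
        intro z u
        have e : z • u = Ab.inv (d u) * Ab.of (z • N u) := by
          rw [map_smul, mul_smul_comm, ← hN u]
        have h1 := key _ (hd u) (z • N u)
        rw [← e] at h1
        rw [h1, map_smul, mul_smul_comm, map_smul, RingHom.id_apply] }
  have hT : ∀ g ∈ denomPoly (p + q), ∀ Y : A p q n θ, T (Ab.inv g * Ab.of Y) =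
      (Jb p q n θ).mkQ (Ab.inv (shift (root c) g) * xi c Y) := key
  refine ⟨T, ?_, ?_⟩
  · intro f g hg Y
    rw [mul_assoc, Ab.poly_apply, ← map_mul, hT g hg, ← sub_eq_zero, ← map_sub,
      Submodule.mkQ_apply, Submodule.Quotient.mk_eq_zero, mul_assoc, ← mul_sub]
    exact inv_mul_Jb (shift_mem _ hg) (xi_poly c f Y)
  · intro T' h'
    ext y
    rw [hN y, hT _ (hd y)]
    have := h' 1 (d y) (hd y) (N y)
    simpa using this

/-- The linear map `ξ̄_c : Ab → Jb \ Ab`, with `ξ̄_c(X Y) = Z ξ_c(Y) + Jb`. -/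
def xiBar (c : Fin (p + q - 1)) : Ab p q n θ →ₗ[ℂ] Ab p q n θ ⧸ Jb p q n θ :=
  (existsUnique_xiBar c).choose

theorem xiBar_apply (c : Fin (p + q - 1)) (f g : MvPolynomial (Fin (p + q)) ℂ)
    (hg : g ∈ denomPoly (p + q)) (Y : A p q n θ) :
    xiBar c (Ab.inv g * Ab.poly f * Ab.of Y) = (Jb p q n θ).mkQ
      (Ab.inv (shift (root c) g) * Ab.poly (shift (root c) f) * xi c Y) :=
  (existsUnique_xiBar c).choose_spec.1 f g hg Y

/-- The transposition `σ_c` of `c` and `c + 1`. -/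
def simpleSwap {m : ℕ} (c : Fin (m - 1)) : Equiv.Perm (Fin m) := Equiv.swap (lo c) (hi c)

/-- `σ_c(Jb) ⊆ ker ξ̄_c`. -/
theorem Jb_le_ker (c : Fin (p + q - 1)) : Jb p q n θ ≤
    LinearMap.ker (xiBar c ∘ₗ (Ab.perm (n := n) (θ := θ) (simpleSwap c)).toLinearMap) := by
  intro j hj
  refine Jb_induction (C := fun j => j ∈ LinearMap.ker
    (xiBar c ∘ₗ (Ab.perm (n := n) (θ := θ) (simpleSwap c)).toLinearMap)) ?_ (zero_mem _)
    (fun u v hu hv => add_mem hu hv) hj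
  intro a b hab y
  rw [LinearMap.mem_ker, LinearMap.comp_apply, AlgHom.toLinearMap_apply, map_mul, Ab.perm_of,
    A.perm_E]
  obtain ⟨g, hg, Y, h⟩ := Ab.exists_rep (Ab.perm (simpleSwap c) y)
  have hw := A.hasWeight_E (n := n) (θ := θ) (simpleSwap c b) (simpleSwap c a)
  have hg' := shift_mem (-(Pi.single (simpleSwap c b) 1 - Pi.single (simpleSwap c a) 1)) hg
  have h1 := Ab.inv_weight hw hg'
  rw [shift_neg] at h1
  rw [h, ← mul_assoc, ← h1, mul_assoc, ← map_mul]
  have h2 := xiBar_apply c 1 _ hg'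
    (A.E p q n θ (simpleSwap c b) (simpleSwap c a) * Y)
  rw [map_one, mul_one] at h2
  rw [h2, map_one, map_one, mul_one, Submodule.mkQ_apply, Submodule.Quotient.mk_eq_zero]
  exact inv_mul_Jb (shift_mem _ hg') (xi_swap c hab Y)

/-- The Zhelobenko operator `ξ̌_c` on `Jb \ Ab`: the map induced by the composition `ξ̄_c σ_c`. -/
def zhelobenko (c : Fin (p + q - 1)) :
    (Ab p q n θ ⧸ Jb p q n θ) →ₗ[ℂ] (Ab p q n θ ⧸ Jb p q n θ) :=
  (Jb p q n θ).liftQ (xiBar c ∘ₗ (Ab.perm (simpleSwap c)).toLinearMap) (Jb_le_ker c)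

end

section
variable {p q n : ℕ} {θ : ℤˣ}

/-- `δ̄ = (δ_1, …, δ_p, -δ_{p+1}, …, -δ_{p+q})`. -/
def barSeq {p q : ℕ} (δ : Fin (p + q) → ℤˣ) (a : Fin (p + q)) : ℤˣ :=
  if a.val < p then δ a else -δ a

/-- The action `σ(δ)`: apply the bar, then permute by `(σ · δ)_a = δ_{σ⁻¹(a)}`, then apply the bar. -/
def actSeq {p q : ℕ} (σ : Equiv.Perm (Fin (p + q))) (δ : Fin (p + q) → ℤˣ) : Fin (p + q) → ℤˣ :=
  barSeq fun a => barSeq δ (σ⁻¹ a)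

/-- The left ideal `Ī_δ` of `Ab`, generated by the `x_{ak}` with `δ_a = -1` and the `∂_{ak}` with
`δ_a = 1`. -/
def Ib (n : ℕ) (θ : ℤˣ) (δ : Fin (p + q) → ℤˣ) : Ideal (Ab p q n θ) :=
  Ideal.span ({y | ∃ (a : Fin (p + q)) (k : Fin n), δ a = -1 ∧ y = Ab.of (A.x p q n θ a k)} ∪
    {y | ∃ (a : Fin (p + q)) (k : Fin n), δ a = 1 ∧ y = Ab.of (A.d p q n θ a k)})

/-- The image of `Ī_δ` in the quotient space `Jb \ Ab`. -/
def IbImage (n : ℕ) (θ : ℤˣ) (δ : Fin (p + q) → ℤˣ) :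
    Submodule ℂ (Ab p q n θ ⧸ Jb p q n θ) :=
  ((Ib n θ δ).restrictScalars ℂ).map (Jb p q n θ).mkQ

/-- The word `c_1, …, c_k` is a reduced decomposition `σ = σ_{c_1} ⋯ σ_{c_k}`, i.e. one of the
least possible length. -/
def IsReducedWord {m : ℕ} (σ : Equiv.Perm (Fin m)) (w : List (Fin (m - 1))) : Prop :=
  (w.map simpleSwap).prod = σ ∧
    ∀ w' : List (Fin (m - 1)), (w'.map simpleSwap).prod = σ → w.length ≤ w'.length

/-- Every permutation has a reduced decomposition. -/
theorem exists_isReducedWord {m : ℕ} (σ : Equiv.Perm (Fin m)) : ∃ w, IsReducedWord σ w := by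
  have : ∃ w : List (Fin (m - 1)), (w.map simpleSwap).prod = σ := by
    rcases m with _ | m
    · exact ⟨[], Subsingleton.elim _ _⟩
    have h : σ ∈ Submonoid.closure (Set.range fun i : Fin m => Equiv.swap i.castSucc i.succ) := by
      rw [Equiv.Perm.mclosure_swap_castSucc_succ]; trivial
    induction h using Submonoid.closure_induction with
    | mem x hx => obtain ⟨i, rfl⟩ := hx; exact ⟨[i], by simp [simpleSwap]; rfl⟩
    | one => exact ⟨[], rfl⟩
    | mul x y _ _ hx hy =>
      obtain ⟨w, rfl⟩ := hx
      obtain ⟨w', rfl⟩ := hy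
      exact ⟨w ++ w', by simp⟩
  obtain ⟨w, hw⟩ := this
  classical
  have h : ∃ k, ∃ w : List (Fin (m - 1)), (w.map simpleSwap).prod = σ ∧ w.length = k := ⟨_, w, hw, rfl⟩
  obtain ⟨w', h1, h2⟩ := Nat.find_spec h
  exact ⟨w', h1, fun v hv => h2 ▸ Nat.find_min' h ⟨v, hv, rfl⟩⟩

/-- The composition `ξ̌_{c_1} ⋯ ξ̌_{c_k}` of Zhelobenko operators. -/
def zhelobenkoWord (n : ℕ) (θ : ℤˣ) (w : List (Fin (p + q - 1))) :
    (Ab p q n θ ⧸ Jb p q n θ) →ₗ[ℂ] (Ab p q n θ ⧸ Jb p q n θ) :=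
  (w.map fun c => (zhelobenko c : Module.End ℂ (Ab p q n θ ⧸ Jb p q n θ))).prod

end

end

end Zhelobenko

/-! Let `ε = δ̄`. In terms of the coordinates `p_{ai}`, `q_{ai}`, the left ideal `Ī_δ` is generated
by the `q_{ak}` with `ε_a = 1` and the `p_{ak}` with `ε_a = -1` (`Ib_eq_span`), so that
`σ ∈ S_m` maps `Ī_δ` to `Ī_{σ(δ)}` (`Ab.perm_mem_Ib`).

The only nonzero brackets of `F_c` with the coordinates are `[F_c, q_{ck}] = q_{c+1,k}` and
`[F_c, p_{c+1,k}] = -p_{ck}`. So `ad F_c` preserves the left ideal of `A` with these generators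
unless `ε_c = 1` and `ε_{c+1} = -1` (`adF_mem_coordIdeal`), and when it does, `ξ̄_c` maps `Ī_δ`
into its own image (`xiBar_mem_IbImage`). Since `ξ̌_c` is induced by `ξ̄_c σ_c`, it maps the
image of `Ī_δ` into that of `Ī_{σ_c(δ)}` unless `ε_c = -1` and `ε_{c+1} = 1`
(`zhelobenko_map_IbImage_le`).

Now apply the factors of a reduced word to `δ⁺`, for which `ε = (1, …, 1, -1, …, -1)`. If the
excluded case arises when `ξ̌_c` is applied after `ξ̌_τ`, then
`τ⁻¹(c) > p ≥ τ⁻¹(c + 1)`, so that `σ_c τ` is shorter than `τ` by the exchange property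
(`exists_shorter_word`), and the word is not reduced. -/

namespace Zhelobenko

section
variable {p q n : ℕ} {θ : ℤˣ}

/-! ### The ideals in terms of the coordinates -/

/-- The coordinates `q_{ak}` with `ε_a = 1` and `p_{ak}` with `ε_a = -1`. -/
def coordGens (n : ℕ) (θ : ℤˣ) (ε : Fin (p + q) → ℤˣ) : Set (A p q n θ) :=
  {u | ∃ a k, ε a = 1 ∧ u = A.Q p q n θ a k} ∪ {u | ∃ a k, ε a = -1 ∧ u = A.P p q n θ a k}

/-- The left ideal of `A` generated by the coordinates `q_{ak}` with `ε_a = 1` and `p_{ak}` with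
`ε_a = -1`. -/
def coordIdeal (n : ℕ) (θ : ℤˣ) (ε : Fin (p + q) → ℤˣ) : Ideal (A p q n θ) :=
  Ideal.span (coordGens n θ ε)

theorem neg_units_smul_mem {R : Type*} [Ring R] (I : Ideal R) {u : R} (hu : u ∈ I) :
    -(θ • u) ∈ I := by
  rcases Int.units_eq_one_or θ with rfl | rfl <;> simpa using hu

theorem Ib_eq_span (δ : Fin (p + q) → ℤˣ) :
    Ib n θ δ = Ideal.span (Ab.of '' coordGens n θ (barSeq δ)) := by
  apply le_antisymm
  · refine Ideal.span_le.2 ?_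
    rintro _ (⟨a, k, ha, rfl⟩ | ⟨a, k, ha, rfl⟩) <;> by_cases hp : a.val < p
    · have hx : A.x p q n θ a k = -(θ • A.P p q n θ a k) := by
        simp [A.P, coordP, hp, smul_smul]
      have h : Ab.of (A.P p q n θ a k) ∈ Ideal.span (Ab.of '' coordGens n θ (barSeq δ)) :=
        Ideal.subset_span ⟨_, Or.inr ⟨a, k, by simp [barSeq, hp, ha], rfl⟩, rfl⟩
      rw [hx, map_neg, map_smul_unit]
      exact neg_units_smul_mem _ h
    · exact Ideal.subset_span ⟨_, Or.inl ⟨a, k, by simp [barSeq, hp, ha], rfl⟩,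
        by simp [A.Q, coordQ, hp]⟩
    · exact Ideal.subset_span ⟨_, Or.inl ⟨a, k, by simp [barSeq, hp, ha], rfl⟩,
        by simp [A.Q, coordQ, hp]⟩
    · exact Ideal.subset_span ⟨_, Or.inr ⟨a, k, by simp [barSeq, hp, ha], rfl⟩,
        by simp [A.P, coordP, hp]⟩
  · refine Ideal.span_le.2 ?_
    rintro _ ⟨_, ⟨a, k, ha, rfl⟩ | ⟨a, k, ha, rfl⟩, rfl⟩ <;> by_cases hp : a.val < p
    · exact Ideal.subset_span (Or.inr ⟨a, k, by simpa [barSeq, hp] using ha,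
        by simp [A.Q, coordQ, hp]⟩)
    · exact Ideal.subset_span (Or.inl ⟨a, k, by simpa [barSeq, hp, neg_eq_iff_eq_neg] using ha,
        by simp [A.Q, coordQ, hp]⟩)
    · have h : Ab.of (A.x p q n θ a k) ∈ Ib n θ δ :=
        Ideal.subset_span (Or.inl ⟨a, k, by simpa [barSeq, hp] using ha, rfl⟩)
      have hP : A.P p q n θ a k = -(θ • A.x p q n θ a k) := by simp [A.P, coordP, hp]
      rw [hP, map_neg, map_smul_unit]
      exact neg_units_smul_mem _ h
    · exact Ideal.subset_span (Or.inr ⟨a, k, by simpa [barSeq, hp] using ha,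
        by simp [A.P, coordP, hp]⟩)

theorem barSeq_barSeq (δ : Fin (p + q) → ℤˣ) : barSeq (barSeq δ) = δ := by
  funext a; by_cases hp : a.val < p <;> simp [barSeq, hp]

theorem barSeq_actSeq (σ : Equiv.Perm (Fin (p + q))) (δ : Fin (p + q) → ℤˣ) (a : Fin (p + q)) :
    barSeq (actSeq σ δ) a = barSeq δ (σ⁻¹ a) := by
  rw [actSeq, barSeq_barSeq]

theorem actSeq_one (δ : Fin (p + q) → ℤˣ) : actSeq 1 δ = δ := barSeq_barSeq δ

theorem actSeq_mul (σ τ : Equiv.Perm (Fin (p + q))) (δ : Fin (p + q) → ℤˣ) :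
    actSeq (σ * τ) δ = actSeq σ (actSeq τ δ) := by
  unfold actSeq
  rw [barSeq_barSeq]
  simp [mul_inv_rev]

theorem Ab.perm_mem_Ib (σ : Equiv.Perm (Fin (p + q))) {δ : Fin (p + q) → ℤˣ} {y : Ab p q n θ}
    (hy : y ∈ Ib n θ δ) : Ab.perm σ y ∈ Ib n θ (actSeq σ δ) := by
  rw [Ib_eq_span] at hy ⊢
  refine Submodule.span_induction ?_ (by simp) (fun u v _ _ hu hv => ?_)
    (fun r u _ hu => ?_) hy
  · rintro _ ⟨_, ⟨a, k, ha, rfl⟩ | ⟨a, k, ha, rfl⟩, rfl⟩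
    · refine Ideal.subset_span ⟨_, Or.inl ⟨σ a, k, ?_, rfl⟩, ?_⟩
      · simpa [barSeq_actSeq] using ha
      · rw [Ab.perm_of, A.perm_Q]
    · refine Ideal.subset_span ⟨_, Or.inr ⟨σ a, k, ?_, rfl⟩, ?_⟩
      · simpa [barSeq_actSeq] using ha
      · rw [Ab.perm_of, A.perm_P]
  · rw [map_add]; exact add_mem hu hv
  · rw [smul_eq_mul, map_mul]; exact Ideal.mul_mem_left _ _ hu

theorem Ab.of_mem_Ib {δ : Fin (p + q) → ℤˣ} {u : A p q n θ}
    (hu : u ∈ coordIdeal n θ (barSeq δ)) : Ab.of u ∈ Ib n θ δ := by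
  rw [Ib_eq_span]
  refine Submodule.span_induction (fun u hu => Ideal.subset_span ⟨u, hu, rfl⟩) (by simp)
    (fun u v _ _ hu hv => ?_) (fun r u _ hu => ?_) hu
  · rw [map_add]; exact add_mem hu hv
  · rw [smul_eq_mul, map_mul]; exact Ideal.mul_mem_left _ _ hu

/-! ### The Zhelobenko operators on the ideals -/

theorem adF_mem_coordIdeal (c : Fin (p + q - 1)) {ε : Fin (p + q) → ℤˣ}
    (hε : ¬ (ε (lo c) = 1 ∧ ε (hi c) = -1)) {u : A p q n θ} (hu : u ∈ coordIdeal n θ ε) :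
    A.adF c u ∈ coordIdeal n θ ε := by
  refine Submodule.span_induction ?_ (by simp) (fun u v _ _ hu hv => ?_)
    (fun r u hu' hu => ?_) hu
  · rintro _ (⟨a, k, ha, rfl⟩ | ⟨a, k, ha, rfl⟩)
    · rw [adF_apply, A.f, A.pq.Eq]
      split_ifs with h
      · subst h
        refine Ideal.subset_span (Or.inl ⟨hi c, k, ?_, rfl⟩)
        exact (Int.units_eq_one_or _).resolve_right fun h => hε ⟨ha, h⟩
      · exact zero_mem _
    · rw [adF_apply, A.f, A.pq.Ep]
      split_ifs with h
      · subst h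
        refine neg_mem (Ideal.subset_span (Or.inr ⟨lo c, k, ?_, rfl⟩))
        exact (Int.units_eq_one_or _).resolve_left fun h => hε ⟨h, ha⟩
      · exact zero_mem _
  · rw [map_add]; exact add_mem hu hv
  · rw [smul_eq_mul, adF_mul]
    exact add_mem (Ideal.mul_mem_left _ _ hu') (Ideal.mul_mem_left _ _ hu)

theorem xi_mem_Ib (c : Fin (p + q - 1)) {δ : Fin (p + q) → ℤˣ}
    (hδ : ¬ (barSeq δ (lo c) = 1 ∧ barSeq δ (hi c) = -1)) {u : A p q n θ}
    (hu : u ∈ coordIdeal n θ (barSeq δ)) : xi c u ∈ Ib n θ δ := by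
  have h : ∀ s, (A.adF c ^ s) u ∈ coordIdeal n θ (barSeq δ) := by
    intro s
    induction s with
    | zero => simpa using hu
    | succ s ih => rw [pow_succ', Module.End.mul_apply]; exact adF_mem_coordIdeal c hδ ih
  obtain ⟨N, hN⟩ := adF_nilp c u
  rw [xi_eq_sum c u hN]
  refine Submodule.sum_mem _ fun s _ => ?_
  rw [xiTerm_apply]
  exact Ideal.mul_mem_left _ _ (Ab.of_mem_Ib (Ideal.mul_mem_left _ _ (h s)))

theorem xiBar_mem_IbImage (c : Fin (p + q - 1)) {δ : Fin (p + q) → ℤˣ}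
    (hδ : ¬ (barSeq δ (lo c) = 1 ∧ barSeq δ (hi c) = -1)) {y : Ab p q n θ}
    (hy : y ∈ Ib n θ δ) : xiBar c y ∈ IbImage n θ δ := by
  rw [Ib_eq_span] at hy
  refine Submodule.closure_induction (by simp) (fun u v _ _ hu hv => ?_) (fun r u hu => ?_) hy
  · rw [map_add]; exact add_mem hu hv
  · obtain ⟨u, hu, rfl⟩ := hu
    obtain ⟨f, hf, Y, rfl⟩ := Ab.exists_rep r
    have h := xiBar_apply c 1 f hf (Y * u)
    simp only [map_one, mul_one] at h
    rw [smul_eq_mul, mul_assoc, ← map_mul, h]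
    exact Submodule.mem_map_of_mem (Ideal.mul_mem_left _ _
      (xi_mem_Ib c hδ (Ideal.mul_mem_left _ _ (Ideal.subset_span hu))))

theorem zhelobenko_map_IbImage_le (c : Fin (p + q - 1)) {δ : Fin (p + q) → ℤˣ}
    (hδ : ¬ (barSeq δ (lo c) = -1 ∧ barSeq δ (hi c) = 1)) :
    (IbImage n θ δ).map (zhelobenko c) ≤ IbImage n θ (actSeq (simpleSwap c) δ) := by
  rintro _ ⟨_, ⟨y, hy, rfl⟩, rfl⟩
  have h : zhelobenko c ((Jb p q n θ).mkQ y) = xiBar c (Ab.perm (simpleSwap c) y) := rfl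
  rw [h]
  refine xiBar_mem_IbImage c ?_ (Ab.perm_mem_Ib _ hy)
  rw [barSeq_actSeq, barSeq_actSeq, simpleSwap, Equiv.swap_inv, Equiv.swap_apply_left,
    Equiv.swap_apply_right]
  exact fun h => hδ h.symm

end

/-! ### Reduced words -/

/-- The exchange property: if `x < y` and `τ⁻¹(y) < τ⁻¹(x)`, where `τ` is the product of the
simple transpositions in a word, then the product of the transposition of `x` and `y` with `τ` is
obtained by deleting one letter of the word. -/
theorem exists_shorter_word {m : ℕ} (w : List (Fin (m - 1))) {x y : Fin m} (hxy : x < y)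
    (h : (w.map simpleSwap).prod⁻¹ y < (w.map simpleSwap).prod⁻¹ x) :
    ∃ w' : List (Fin (m - 1)), w'.length < w.length ∧
      (w'.map simpleSwap).prod = Equiv.swap x y * (w.map simpleSwap).prod := by
  induction w generalizing x y with
  | nil => exact absurd h (by simpa using hxy.le)
  | cons c w ih =>
    rw [List.map_cons, List.prod_cons] at h ⊢
    by_cases hc : x = lo c ∧ y = hi c
    · obtain ⟨rfl, rfl⟩ := hc
      exact ⟨w, by simp, by simp [simpleSwap]⟩
    · have hlt : simpleSwap c x < simpleSwap c y := by
        rw [simpleSwap, Equiv.swap_apply_def, Equiv.swap_apply_def]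
        simp only [lo, hi, Fin.ext_iff, Fin.lt_def] at *
        split_ifs <;> (try dsimp only) <;> omega
      have hinv : (simpleSwap c)⁻¹ = simpleSwap c := Equiv.swap_inv _ _
      rw [mul_inv_rev, hinv, Equiv.Perm.mul_apply, Equiv.Perm.mul_apply] at h
      obtain ⟨w', hl, hw'⟩ := ih hlt h
      refine ⟨c :: w', by simpa using hl, ?_⟩
      rw [List.map_cons, List.prod_cons, hw', Equiv.swap_apply_apply, hinv, ← mul_assoc,
        ← mul_assoc, ← mul_assoc, simpleSwap, Equiv.swap_mul_self, one_mul, mul_assoc]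

theorem IsReducedWord.tail {m : ℕ} {σ : Equiv.Perm (Fin m)} {c : Fin (m - 1)}
    {w : List (Fin (m - 1))} (h : IsReducedWord σ (c :: w)) :
    IsReducedWord (w.map simpleSwap).prod w := by
  refine ⟨rfl, fun w' hw' => ?_⟩
  have := h.2 (c :: w') (by rw [← h.1, List.map_cons, List.prod_cons, hw']; rfl)
  simpa using this

theorem IsReducedWord.inv_lo_lt_inv_hi {m : ℕ} {σ : Equiv.Perm (Fin m)} {c : Fin (m - 1)}
    {w : List (Fin (m - 1))} (h : IsReducedWord σ (c :: w)) :
    (w.map simpleSwap).prod⁻¹ (lo c) < (w.map simpleSwap).prod⁻¹ (hi c) := by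
  by_contra hn
  have hlt := lt_of_le_of_ne (not_lt.1 hn)
    fun e => lo_ne_hi c ((Equiv.injective _ e).symm)
  obtain ⟨w', hl, hw'⟩ := exists_shorter_word w (lo_lt_hi c) hlt
  have := h.2 w' (by rw [hw', ← h.1]; rfl)
  rw [List.length_cons] at this
  omega

end Zhelobenko

theorem proposition3p1 (p q n : ℕ) (θ : ℤˣ) (σ : Equiv.Perm (Fin (p + q)))
    (w : List (Fin (p + q - 1))) (hw : Zhelobenko.IsReducedWord σ w) :
    Submodule.map (Zhelobenko.zhelobenkoWord (p := p) (q := q) n θ w)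
        (Zhelobenko.IbImage (p := p) (q := q) n θ (fun _ => 1)) ≤
      Zhelobenko.IbImage (p := p) (q := q) n θ (Zhelobenko.actSeq (p := p) (q := q) σ (fun _ => 1)) := by
  induction w generalizing σ with
  | nil =>
    obtain rfl : 1 = σ := hw.1
    rw [Zhelobenko.actSeq_one]
    exact (Submodule.map_id _).le
  | cons c w ih =>
    have hσ : Zhelobenko.simpleSwap c * (w.map Zhelobenko.simpleSwap).prod = σ := hw.1
    have hlt := hw.inv_lo_lt_inv_hi
    have hword : Zhelobenko.zhelobenkoWord (p := p) (q := q) n θ (c :: w) =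
        Zhelobenko.zhelobenko c ∘ₗ Zhelobenko.zhelobenkoWord n θ w := rfl
    rw [hword, Submodule.map_comp, ← hσ, Zhelobenko.actSeq_mul]
    refine (Submodule.map_mono (ih _ hw.tail)).trans
      (Zhelobenko.zhelobenko_map_IbImage_le c ?_)
    rw [Zhelobenko.barSeq_actSeq, Zhelobenko.barSeq_actSeq]
    -- the sequence `(1, …, 1, -1, …, -1)` is decreasing, so `-1` cannot come before `1`
    rintro ⟨h1, h2⟩
    simp only [Zhelobenko.barSeq] at h1 h2
    rw [Fin.lt_def] at hlt
    split_ifs at h1 h2 <;> first | omega | exact absurd h1 (by decide) | exact absurd h2 (by decide)
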